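/- For a prime $p$ write $\mathbf{e}_p(z)=\exp(2\pi i z/p)$. For integers $d\ge 1$ and $1\le U,V<p$, elements $a,b\in\mathbb{F}_p$ with $a\neq 0$, a convex set $\mathfrak{C}\subseteq[1,U]\times[1,V]$ in the plane, and sequences of complex weights $\mathcal{A}=\{\alpha_u\}_{u=1}^{U}$, $\mathcal{B}=\{\beta_v\}_{v=1}^{V}$ with $|\alpha_u|,|\beta_v|\le 1$, put $$S_{a,b,d}(\mathcal{A},\mathcal{B};\mathfrak{C})=\sum_{\substack{(u,v)\in\mathfrak{C}\cap\mathbb{Z}^2\\ au+b\neq 0\text{ in }\mathbb{F}_p}}\alpha_u\,\beta_v\,\mathbf{e}_p\!\left(\frac{v}{(au+b)^d}\right),$$ where the division is carried out in $\mathbb{F}_p$. **Theorem.** For any fixed integers $d\ge 1$ and $k\ge 1$, as $p\to\infty$ through the primes, $$|S_{a,b,d}(\mathcal{A},\mathcal{B};\mathfrak{C})|\le V^{1-1/(2k)}\left(U+U^{k/(k+1)}\,p^{1/(2k)}\right)p^{o(1)},$$ uniformly over all $U$, $V$, $a$, $b$, $\mathfrak{C}$, $\mathcal{A}$, $\mathcal{B}$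 as above. That is, for all integers $d,k\ge 1$ and every real $\varepsilon>0$ there is a $p_0$, depending only on $d$, $k$ and $\varepsilon$, such that for every prime $p\ge p_0$ and all $U,V,a,b,\mathfrak{C},\mathcal{A},\mathcal{B}$ as above, the inequality holds with $p^{\varepsilon}$ in place of $p^{o(1)}$. -/

import Mathlib

open Polynomial

open scoped Classical in
/-- The bilinear exponential sum `S_f(α, β; 𝓒) = ∑_{(u,v) ∈ 𝓒} α_u β_v e_p(v / f(u))` over the
integer points `(u, v)` of a planar region `𝓒 ⊆ [1, U] × [1, V]`. The points at which `f(u) = 0`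
in `ZMod p` are left out, and the division takes place in the field `ZMod p`. Here
`e_p(z) = exp (2 π i z / p)` is `ZMod.stdAddChar`. -/
noncomputable def bilinearExpSum (p : ℕ) [Fact p.Prime] (f : (ZMod p)[X]) (U V : ℕ)
    (α β : ℕ → ℂ) (𝓒 : Set (ℝ × ℝ)) : ℂ :=
  ∑ w ∈ (Finset.Icc 1 U ×ˢ Finset.Icc 1 V).filter
      (fun w : ℕ × ℕ => ((w.1 : ℝ), (w.2 : ℝ)) ∈ 𝓒 ∧ f.eval (w.1 : ZMod p) ≠ 0),
    α w.1 * β w.2 * ZMod.stdAddChar ((w.2 : ZMod p) / f.eval (w.1 : ZMod p))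

/-- The sum `S_{a,b,d}(α, β; 𝓒)`, that is, `S_f(α, β; 𝓒)` for `f(X) = (aX + b)^d`. -/
noncomputable def bilinearExpSumLinPow (p : ℕ) [Fact p.Prime] (a b : ZMod p) (d U V : ℕ)
    (α β : ℕ → ℂ) (𝓒 : Set (ℝ × ℝ)) : ℂ :=
  bilinearExpSum p ((C a * X + C b) ^ d) U V α β 𝓒

/-! Convexity makes each `v`-section of the region an interval in `u`. Its indicator is expanded in
additive characters (`indicator_interval_eq`). The coefficients have a majorant independent of `v`
with total mass `O(log p)`, and the twist `e_p(hu)` is absorbed into the arbitrary weights. Hölder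
in `v`, followed by extending `v` to all residues, leaves the `2k`-th moment over `l` of `∑ αₙ e_p(l
(c+n)⁻ᵈ)` with `n ≤ N`, which `sum_norm_pow_reciprocal_le` bounds.

By orthogonality this moment counts weighted solutions of an additive equation, so it only grows
when the weights are replaced by a nonnegative majorant. The majorant used is an average of
progressions `j + q u` with `q ≤ Q`, `u < M`, `QM ≤ N`. After Minkowski's inequality and the scaling
`c + j + q u = q (σ + u)`, each progression contributes an energy `E(σ)` that depends only on the
ratio `σ`, which occurs with multiplicity `w(σ)`. Hölder reduces the problem to three averages: `∑
w`, which is trivial; `∑ w²`, an elementary count of equal ratios (`sum_ratioCount_sq_le`); and `∑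
E(σ)` over the support of `w`. For the last, a nondiagonal pair of tuples solves the equation for
only `O(kd)` values of `σ`, the zeros of a nonzero rational function
(`sum_card_energySolutions_le`).

Up to logarithms the moment is `p N^(2k) / M^k`, provided `M^k ≪ min(p, NQ)`. The choice `M ≈
min(N^(2/(k+1)), p^(1/k))`, `Q = ⌊N/M⌋` gives the two terms of the bound. -/

/-! ### Even moments of exponential sums and additive energy. -/

section Moments

variable {p : ℕ} [Fact p.Prime] {ι : Type*} [Fintype ι]

/-- The pairs of `k`-tuples over which `y` has equal sums. -/
noncomputable def energySolutions (k : ℕ) (y : ι → ZMod p) :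
    Finset ((Fin k → ι) × (Fin k → ι)) :=
  open scoped Classical in
  Finset.univ.filter fun w => ∑ i, y (w.1 i) = ∑ i, y (w.2 i)

lemma mem_energySolutions {k : ℕ} {y : ι → ZMod p} {w : (Fin k → ι) × (Fin k → ι)} :
    w ∈ energySolutions k y ↔ ∑ i, y (w.1 i) = ∑ i, y (w.2 i) := by
  simp [energySolutions]

lemma conj_stdAddChar (x : ZMod p) :
    (starRingEnd ℂ) (ZMod.stdAddChar x) = ZMod.stdAddChar (-x) :=
  (AddChar.map_neg_eq_conj _ _).symm

lemma stdAddChar_sum {κ : Type*} (s : Finset κ) (f : κ → ZMod p) :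
    (ZMod.stdAddChar (∑ i ∈ s, f i) : ℂ) = ∏ i ∈ s, (ZMod.stdAddChar (f i) : ℂ) := by
  classical
  induction s using Finset.induction_on with
  | empty => simp
  | insert a s ha ih => rw [Finset.sum_insert ha, Finset.prod_insert ha, AddChar.map_add_eq_mul, ih]

lemma sum_norm_pow_eq (k : ℕ) (y : ι → ZMod p) (α : ι → ℂ) :
    ((∑ l : ZMod p, ‖∑ i, α i * ZMod.stdAddChar (l * y i)‖ ^ (2 * k) : ℝ) : ℂ) =
      p * ∑ w ∈ energySolutions k y,
        (∏ i, α (w.1 i)) * ∏ i, (starRingEnd ℂ) (α (w.2 i)) := by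
  classical
  have h1 (l : ZMod p) : ((‖∑ i, α i * ZMod.stdAddChar (l * y i)‖ ^ (2 * k) : ℝ) : ℂ) =
      ∑ w : (Fin k → ι) × (Fin k → ι), ((∏ i, α (w.1 i)) * ∏ i, (starRingEnd ℂ) (α (w.2 i))) *
        ZMod.stdAddChar (l * (∑ i, y (w.1 i) - ∑ i, y (w.2 i))) := by
    rw [pow_mul, Complex.ofReal_pow, Complex.ofReal_pow, ← Complex.mul_conj', mul_pow, ← map_pow,
      Fintype.sum_pow, map_sum, Finset.sum_mul_sum, ← Finset.univ_product_univ,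
      Finset.sum_product]
    refine Finset.sum_congr rfl fun a _ => Finset.sum_congr rfl fun b _ => ?_
    simp only [map_prod, map_mul, Finset.prod_mul_distrib, conj_stdAddChar]
    rw [mul_sub, sub_eq_add_neg, AddChar.map_add_eq_mul, Finset.mul_sum, Finset.mul_sum,
      ← Finset.sum_neg_distrib, stdAddChar_sum, stdAddChar_sum]
    ring
  push_cast at h1 ⊢
  simp_rw [h1]
  rw [Finset.sum_comm]
  simp_rw [← Finset.mul_sum, AddChar.sum_mulShift _ (ZMod.isPrimitive_stdAddChar p), ZMod.card,
    sub_eq_zero]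
  rw [energySolutions, Finset.sum_filter, Finset.mul_sum]
  refine Finset.sum_congr rfl fun w _ => ?_
  split_ifs <;> simp [mul_comm]

lemma sum_norm_pow_eq_card (k : ℕ) (y : ι → ZMod p) :
    ∑ l : ZMod p, ‖∑ i, (ZMod.stdAddChar (l * y i) : ℂ)‖ ^ (2 * k) =
      p * ((energySolutions k y).card : ℝ) := by
  have h := sum_norm_pow_eq k y fun _ => 1
  simp only [one_mul, Finset.prod_const_one, map_one, mul_one, Finset.sum_const, nsmul_eq_mul] at h
  exact_mod_cast h

/-- The even moment is `p` times a sum of products of weights over solutions, so the triangle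
inequality removes all phases and each `‖α i‖` may then be enlarged to `ω i`. -/
lemma sum_norm_pow_mono (k : ℕ) (y : ι → ZMod p) (α : ι → ℂ) (ω : ι → ℝ)
    (h : ∀ i, ‖α i‖ ≤ ω i) :
    ∑ l : ZMod p, ‖∑ i, α i * ZMod.stdAddChar (l * y i)‖ ^ (2 * k) ≤
      ∑ l : ZMod p, ‖∑ i, (ω i : ℂ) * ZMod.stdAddChar (l * y i)‖ ^ (2 * k) := by
  have e2 : ∑ l : ZMod p, ‖∑ i, (ω i : ℂ) * ZMod.stdAddChar (l * y i)‖ ^ (2 * k) =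
      p * ∑ w ∈ energySolutions k y, (∏ i, ω (w.1 i)) * ∏ i, ω (w.2 i) := by
    have h := sum_norm_pow_eq k y fun i => (ω i : ℂ)
    simp only [Complex.conj_ofReal] at h
    exact_mod_cast h
  rw [e2]
  have e1 := congrArg norm (sum_norm_pow_eq k y α)
  rw [Complex.norm_real, Real.norm_of_nonneg (by positivity)] at e1
  rw [e1, norm_mul, Complex.norm_natCast]
  gcongr
  refine (norm_sum_le _ _).trans (Finset.sum_le_sum fun w _ => ?_)
  simp only [norm_mul, norm_prod, RCLike.norm_conj]
  gcongr with i _ i _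
  · exact Finset.prod_nonneg fun i _ => (norm_nonneg _).trans (h _)
  · exact h _
  · exact h _

/-- Minkowski's inequality for finitely many complex functions on a finite type. -/
lemma minkowski_sum {κ : Type*} (s : Finset κ) (f : κ → ι → ℂ) {m : ℕ} (hm : 1 ≤ m) :
    (∑ l, ‖∑ i ∈ s, f i l‖ ^ m) ^ (1 / (m : ℝ)) ≤
      ∑ i ∈ s, (∑ l, ‖f i l‖ ^ m) ^ (1 / (m : ℝ)) := by
  have : Fact ((1 : ENNReal) ≤ m) := ⟨by exact_mod_cast hm⟩
  have key := norm_sum_le s fun i => (WithLp.toLp (m : ENNReal) (f i))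
  have hpos : 0 < (m : ENNReal).toReal := by simp; omega
  simp only [PiLp.norm_eq_sum hpos, ENNReal.toReal_natCast, Real.rpow_natCast] at key
  have e (l : ι) : (∑ i ∈ s, WithLp.toLp (m : ENNReal) (f i)).ofLp l = ∑ i ∈ s, f i l := by
    rw [WithLp.ofLp_sum, Finset.sum_apply]
  simp only [e] at key
  exact key

end Moments

/-! ### Replacing an interval by an average of progressions. -/

section Shift

variable {p : ℕ} [Fact p.Prime]

/-- For every `(q, u)` the point `n` equals `j + q u - N` with `j = n + N - q u` in `[0, 2N]`,
because `q u ≤ QM ≤ N`. Hence the normalized number of representations is at least `1` on the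
interval and serves as the majorant in `sum_norm_pow_mono`. -/
lemma sum_norm_pow_shift_le (k : ℕ) (g : ZMod p → ZMod p) (c : ZMod p) {N Q M : ℕ} (hN : N < p)
    (hQ : 1 ≤ Q) (hM : 1 ≤ M) (hQM : Q * M ≤ N) (α : ℕ → ℂ) (hα : ∀ n ∈ Finset.Icc 1 N, ‖α n‖ ≤ 1) :
    ∑ l : ZMod p, ‖∑ n ∈ Finset.Icc 1 N, α n * ZMod.stdAddChar (l * g (c + n))‖ ^ (2 * k) ≤
      ((Q * M : ℝ) ^ (2 * k))⁻¹ * ∑ l : ZMod p,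
        ‖∑ j ∈ Finset.range (2 * N + 1) ×ˢ Finset.Icc 1 Q, ∑ u : Fin M,
          (ZMod.stdAddChar (l * g (c - N + j.1 + j.2 * u)) : ℂ)‖ ^ (2 * k) := by
  classical
  set T := (Finset.range (2 * N + 1) ×ˢ Finset.Icc 1 Q) ×ˢ (Finset.univ : Finset (Fin M)) with hT
  let x : (ℕ × ℕ) × Fin M → ZMod p := fun t => c - N + t.1.1 + t.1.2 * (t.2 : ℕ)
  let α' : ZMod p → ℂ := fun z => ∑ n ∈ Finset.Icc 1 N with (c + (n : ℕ) : ZMod p) = z, α n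
  let ω : ZMod p → ℝ := fun z => ((T.filter fun t => x t = z).card : ℝ) / (Q * M)
  have hQM0 : (0 : ℝ) < Q * M := by positivity
  have key := sum_norm_pow_mono k g α' ω (fun z => by
    by_cases hz : ∃ n ∈ Finset.Icc 1 N, (c + (n : ℕ) : ZMod p) = z
    · obtain ⟨n, hn, rfl⟩ := hz
      -- As `N < p`, the residues `c + n` are distinct and each fibre holds one weight.
      have h1 : α' (c + n) = α n := by
        rw [show α' (c + n) = ∑ m ∈ Finset.Icc 1 N with (c + (m : ℕ) : ZMod p) = c + n, α m from rfl]
        rw [Finset.sum_eq_single_of_mem n (by simpa using hn)]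
        intro m hm hmn
        exfalso
        apply hmn
        simp only [Finset.mem_filter, Finset.mem_Icc, add_right_inj] at hm hn
        rw [ZMod.natCast_eq_natCast_iff', Nat.mod_eq_of_lt (by omega),
          Nat.mod_eq_of_lt (by omega)] at hm
        exact hm.2
      rw [h1]
      refine (hα n hn).trans ?_
      rw [le_div_iff₀ hQM0, one_mul]
      have : (Finset.Icc 1 Q ×ˢ (Finset.univ : Finset (Fin M))).card ≤
          (T.filter fun t => x t = c + n).card := by
        refine Finset.card_le_card_of_injOn
          (fun s => ((n + N - s.1 * s.2, s.1), s.2)) ?_ ?_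
        · rintro ⟨q, u⟩ hs
          simp only [Finset.coe_product, Set.mem_prod, Finset.mem_coe, Finset.mem_Icc] at hs hn
          have hqu : q * u ≤ N := (Nat.mul_le_mul hs.1.2 u.2.le).trans hQM
          simp only [Finset.coe_filter, Set.mem_ofPred_eq, hT, Finset.mem_product, Finset.mem_range,
            Finset.mem_Icc, Finset.mem_univ, and_true, x]
          refine ⟨⟨by omega, hs.1⟩, ?_⟩
          rw [Nat.cast_sub (by omega)]
          push_cast
          ring
        · rintro ⟨q, u⟩ _ ⟨q', u'⟩ _ h
          simp only [Prod.mk.injEq] at h ⊢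
          exact ⟨h.1.2, h.2⟩
      simp only [Finset.card_product, Nat.card_Icc, Finset.card_univ, Fintype.card_fin,
        Nat.add_sub_cancel] at this
      exact_mod_cast this
    · have : α' z = 0 := by
        refine Finset.sum_eq_zero fun n hn => ?_
        simp only [Finset.mem_filter] at hn
        exact absurd ⟨n, hn.1, hn.2⟩ hz
      rw [this, norm_zero]
      positivity)
  have e1 (l : ZMod p) : ∑ z, α' z * ZMod.stdAddChar (l * g z) =
      ∑ n ∈ Finset.Icc 1 N, α n * ZMod.stdAddChar (l * g (c + n)) := by
    rw [← Finset.sum_fiberwise (Finset.Icc 1 N) fun n : ℕ => (c + n : ZMod p)]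
    refine Finset.sum_congr rfl fun z _ => ?_
    rw [Finset.sum_mul]
    refine Finset.sum_congr rfl fun n hn => ?_
    rw [(Finset.mem_filter.1 hn).2]
  have e2 (l : ZMod p) : ∑ z, (ω z : ℂ) * ZMod.stdAddChar (l * g z) =
      ((Q * M : ℝ) : ℂ)⁻¹ * ∑ j ∈ Finset.range (2 * N + 1) ×ˢ Finset.Icc 1 Q, ∑ u : Fin M,
          (ZMod.stdAddChar (l * g (c - N + j.1 + j.2 * u)) : ℂ) := by
    rw [← Finset.sum_product', ← Finset.sum_fiberwise T x, Finset.mul_sum]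
    refine Finset.sum_congr rfl fun z _ => ?_
    rw [Finset.sum_congr rfl (g := fun _ => (ZMod.stdAddChar (l * g z) : ℂ)) (fun t ht => by
      rw [← (Finset.mem_filter.1 ht).2]), Finset.sum_const, nsmul_eq_mul]
    simp only [ω]
    push_cast
    ring
  simp_rw [e1, e2, norm_mul, mul_pow] at key
  rw [← Finset.mul_sum, norm_inv, Complex.norm_real, Real.norm_of_nonneg hQM0.le, inv_pow] at key
  exact key

end Shift

/-! ### Average energy over shifts, by counting roots. -/

section Roots

variable {p : ℕ} [Fact p.Prime]

/-- Two tuples taking each value equally often differ by a permutation. -/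
lemma exists_perm_of_card_fiber_eq {ι κ : Type*} [Fintype ι] [DecidableEq κ] (a b : ι → κ)
    (h : ∀ c, (Finset.univ.filter fun i => a i = c).card =
      (Finset.univ.filter fun i => b i = c).card) : ∃ π : Equiv.Perm ι, b ∘ π = a := by
  have e (c : κ) : Nonempty ({i // a i = c} ≃ {i // b i = c}) := by
    rw [← Fintype.card_eq, Fintype.card_subtype, Fintype.card_subtype]
    exact h c
  exact ⟨Equiv.ofFiberEquiv fun c => (e c).some, funext fun i => Equiv.ofFiberEquiv_map _ i⟩

lemma sum_comp_eq_sum_card_mul {ι κ R : Type*} [Fintype ι] [DecidableEq κ] [CommRing R]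
    (a : ι → κ) (y : κ → R) (S : Finset κ) (hS : ∀ i, a i ∈ S) :
    ∑ i, y (a i) = ∑ c ∈ S, ((Finset.univ.filter fun i => a i = c).card : R) * y c := by
  rw [← Finset.sum_fiberwise_of_maps_to (s := Finset.univ) (t := S) (g := a) fun i _ => hS i]
  refine Finset.sum_congr rfl fun c _ => ?_
  rw [Finset.sum_congr rfl (g := fun _ => y c) fun i hi => by rw [(Finset.mem_filter.1 hi).2],
    Finset.sum_const, nsmul_eq_mul]

/-- A nontrivial combination of the functions `(σ + c)⁻ᵈ` has few zeros `σ`. -/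
lemma card_zeros_le {κ : Type*} [DecidableEq κ] {d : ℕ} (hd : 1 ≤ d) (S : Finset κ)
    (z m : κ → ZMod p) (hz : Set.InjOn z S) {c₀ : κ} (hc₀ : c₀ ∈ S) (hm : m c₀ ≠ 0)
    (A : Finset (ZMod p)) (hA : ∀ σ ∈ A, ∑ c ∈ S, m c * ((σ + z c) ^ d)⁻¹ = 0) :
    A.card ≤ S.card * d + S.card := by
  classical
  -- The numerator after clearing denominators. At `-z c₀` only the `c₀` term survives, so `R` is
  -- not the zero polynomial.
  let R : (ZMod p)[X] := ∑ c ∈ S, C (m c) * ∏ c' ∈ S.erase c, (X + C (z c')) ^ d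
  have hR : R.eval (-z c₀) ≠ 0 := by
    have : R.eval (-z c₀) = m c₀ * ∏ c' ∈ S.erase c₀, (-z c₀ + z c') ^ d := by
      simp only [R, eval_finsetSum, eval_mul, eval_C, eval_prod, eval_pow, eval_add, eval_X]
      refine Finset.sum_eq_single_of_mem c₀ hc₀ fun c _ hne => ?_
      rw [Finset.prod_eq_zero (i := c₀) (Finset.mem_erase.2 ⟨hne.symm, hc₀⟩), mul_zero]
      rw [neg_add_cancel, zero_pow (by omega)]
    rw [this]
    refine mul_ne_zero hm (Finset.prod_ne_zero_iff.2 fun c' hc' => pow_ne_zero _ ?_)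
    rw [Finset.mem_erase] at hc'
    intro h0
    exact hc'.1 (hz hc'.2 hc₀ (by linear_combination h0))
  have hR0 : R ≠ 0 := fun h => hR (by rw [h, eval_zero])
  -- `B` accounts for those `σ` at which a denominator vanishes and the inverse takes its default
  -- value `0`.
  let B : (ZMod p)[X] := ∏ c ∈ S, (X + C (z c))
  have hB0 : B ≠ 0 := Finset.prod_ne_zero_iff.2 fun c _ => (monic_X_add_C _).ne_zero
  have hdegB : B.natDegree ≤ S.card := by
    refine (natDegree_prod_le _ _).trans ((Finset.sum_le_card_nsmul _ _ 1 fun c _ => ?_).trans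
      (by simp))
    simp
  have hdegR : R.natDegree ≤ S.card * d := by
    refine natDegree_sum_le_of_forall_le _ _ fun c hc => ?_
    refine (natDegree_C_mul_le _ _).trans ((natDegree_prod_le _ _).trans
      ((Finset.sum_le_card_nsmul _ _ d fun c _ => ?_).trans ?_))
    · refine natDegree_pow_le.trans ?_
      simp
    · rw [smul_eq_mul]
      exact Nat.mul_le_mul_right _ (Finset.card_le_card (Finset.erase_subset _ _))
  have hsub : A ⊆ (R * B).roots.toFinset := by
    intro σ hσ
    rw [Multiset.mem_toFinset, mem_roots (mul_ne_zero hR0 hB0), IsRoot.def, eval_mul]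
    by_cases hz0 : ∃ c ∈ S, σ + z c = 0
    · obtain ⟨c, hc, h0⟩ := hz0
      have : B.eval σ = 0 := by
        simp only [B, eval_prod]
        exact Finset.prod_eq_zero hc (by simpa using h0)
      rw [this, mul_zero]
    · push Not at hz0
      have : R.eval σ = (∏ c ∈ S, (σ + z c) ^ d) * ∑ c ∈ S, m c * ((σ + z c) ^ d)⁻¹ := by
        simp only [R, eval_finsetSum, eval_mul, eval_C, eval_prod, eval_pow, eval_add, eval_X]
        rw [Finset.mul_sum]
        refine Finset.sum_congr rfl fun c hc => ?_
        rw [← Finset.mul_prod_erase S _ hc]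
        have := pow_ne_zero d (hz0 c hc)
        field_simp
      rw [this, hA σ hσ, mul_zero, zero_mul]
  calc A.card ≤ (R * B).roots.toFinset.card := Finset.card_le_card hsub
    _ ≤ (R * B).natDegree := (Multiset.toFinset_card_le _).trans (card_roots' _)
    _ ≤ S.card * d + S.card := natDegree_mul_le.trans (add_le_add hdegR hdegB)

/-- If `a` and `b` are not permutations of each other, some value has different multiplicities in
them. Both are at most `k < p`, so their difference stays nonzero mod `p` and `card_zeros_le`
applies. -/
lemma card_shifts_le {d k M : ℕ} (hd : 1 ≤ d) (hk : k < p) (hM : M ≤ p)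
    (a b : Fin k → Fin M) (hab : ¬ ∃ π : Equiv.Perm (Fin k), b ∘ π = a) (A : Finset (ZMod p))
    (hA : ∀ σ ∈ A, (a, b) ∈ energySolutions k fun u : Fin M => ((σ + ((u : ℕ) : ZMod p)) ^ d)⁻¹) :
    A.card ≤ 2 * k * d + 2 * k := by
  classical
  let S := Finset.univ.image a ∪ Finset.univ.image b
  let na : Fin M → ℕ := fun c => (Finset.univ.filter fun i => a i = c).card
  let nb : Fin M → ℕ := fun c => (Finset.univ.filter fun i => b i = c).card
  obtain ⟨c₀, hc₀⟩ : ∃ c, na c ≠ nb c := by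
    by_contra! h
    exact hab (exists_perm_of_card_fiber_eq a b h)
  have hle (f : Fin k → Fin M) (c : Fin M) : (Finset.univ.filter fun i => f i = c).card < p :=
    ((Finset.card_le_univ _).trans (by simp)).trans_lt hk
  have hmem : c₀ ∈ S := by
    by_contra hc
    simp only [S, Finset.mem_union, Finset.mem_image, Finset.mem_univ, true_and, not_or,
      not_exists] at hc
    apply hc₀
    simp only [na, nb]
    rw [Finset.filter_false_of_mem fun i _ => hc.1 i, Finset.filter_false_of_mem fun i _ => hc.2 i]
  have hS : S.card ≤ 2 * k := by
    refine (Finset.card_union_le _ _).trans ?_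
    have h1 := Finset.card_image_le (s := Finset.univ) (f := a)
    have h2 := Finset.card_image_le (s := Finset.univ) (f := b)
    rw [Finset.card_univ, Fintype.card_fin] at h1 h2
    omega
  have := card_zeros_le hd S (fun c => ((c : ℕ) : ZMod p)) (fun c => (na c : ZMod p) - nb c)
    (by
      intro c _ c' _ h
      simp only at h
      rw [ZMod.natCast_eq_natCast_iff', Nat.mod_eq_of_lt (c.2.trans_le hM),
        Nat.mod_eq_of_lt (c'.2.trans_le hM)] at h
      exact Fin.ext h)
    hmem (by
      rw [sub_ne_zero]
      intro h
      rw [ZMod.natCast_eq_natCast_iff', Nat.mod_eq_of_lt (hle a c₀),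
        Nat.mod_eq_of_lt (hle b c₀)] at h
      exact hc₀ h) A (by
      intro σ hσ
      have h := mem_energySolutions.1 (hA σ hσ)
      simp only at h
      rw [sum_comp_eq_sum_card_mul a (fun u : Fin M => ((σ + ((u : ℕ) : ZMod p)) ^ d)⁻¹) S
          (fun i => by simp [S]),
        sum_comp_eq_sum_card_mul b (fun u : Fin M => ((σ + ((u : ℕ) : ZMod p)) ^ d)⁻¹) S
          (fun i => by simp [S]), ← sub_eq_zero, ← Finset.sum_sub_distrib] at h
      rw [← h]
      refine Finset.sum_congr rfl fun c _ => ?_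
      simp only [na, nb]
      ring)
  refine this.trans ?_
  gcongr

/-- Diagonal pairs number at most `k! M^k` for each shift. For the other pairs the order of
summation is exchanged: each of the at most `M^(2k)` pairs is a solution for a bounded number of
shifts. -/
lemma sum_card_energySolutions_le {d k M : ℕ} (hd : 1 ≤ d) (hk : k < p) (hM : M ≤ p)
    (T : Finset (ZMod p)) :
    ∑ σ ∈ T, (energySolutions k fun u : Fin M => ((σ + ((u : ℕ) : ZMod p)) ^ d)⁻¹).card ≤
      T.card * (k.factorial * M ^ k) + (2 * k * d + 2 * k) * M ^ (2 * k) := by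
  classical
  let triv : Finset ((Fin k → Fin M) × (Fin k → Fin M)) :=
    Finset.univ.filter fun w => ∃ π : Equiv.Perm (Fin k), w.2 ∘ π = w.1
  have htriv : triv.card ≤ k.factorial * M ^ k := by
    have : triv ⊆ Finset.univ.image
        fun t : Equiv.Perm (Fin k) × (Fin k → Fin M) => (t.2 ∘ t.1, t.2) := by
      rintro ⟨a, b⟩ h
      obtain ⟨π, h⟩ := (Finset.mem_filter.1 h).2
      exact Finset.mem_image.2 ⟨(π, b), Finset.mem_univ _, by simpa using h⟩
    refine (Finset.card_le_card this).trans (Finset.card_image_le.trans ?_)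
    simp [Fintype.card_perm]
  let sol (σ : ZMod p) := energySolutions k fun u : Fin M => ((σ + ((u : ℕ) : ZMod p)) ^ d)⁻¹
  have h1 (σ : ZMod p) : (sol σ).card ≤ k.factorial * M ^ k + ((sol σ) \ triv).card := by
    have := Finset.card_le_card_sdiff_add_card (s := sol σ) (t := triv)
    omega
  have h2 : ∑ σ ∈ T, ((sol σ) \ triv).card ≤ (2 * k * d + 2 * k) * M ^ (2 * k) := by
    have e : ∑ σ ∈ T, ((sol σ) \ triv).card =
        ∑ w : (Fin k → Fin M) × (Fin k → Fin M), (T.filter fun σ => w ∈ sol σ \ triv).card := by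
      simp only [Finset.card_eq_sum_ones, Finset.sum_filter]
      rw [Finset.sum_comm]
      refine Finset.sum_congr rfl fun σ _ => ?_
      rw [← Finset.sum_filter]
      congr 1
      ext w
      simp
    rw [e]
    refine (Finset.sum_le_card_nsmul _ _ (2 * k * d + 2 * k) ?_).trans ?_
    · rintro ⟨a, b⟩ _
      by_cases hw : (a, b) ∈ triv
      · simp [hw]
      · refine card_shifts_le hd hk hM a b (by simpa [triv] using hw) _ fun σ hσ => ?_
        exact (Finset.mem_sdiff.1 (Finset.mem_filter.1 hσ).2).1
    · simp only [Finset.card_univ, Fintype.card_prod, Fintype.card_fun, Fintype.card_fin,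
        smul_eq_mul]
      apply le_of_eq
      ring
  calc ∑ σ ∈ T, (sol σ).card ≤ ∑ σ ∈ T, (k.factorial * M ^ k + ((sol σ) \ triv).card) :=
        Finset.sum_le_sum fun σ _ => h1 σ
    _ ≤ _ := by
      rw [Finset.sum_add_distrib, Finset.sum_const, smul_eq_mul]
      omega

end Roots

/-! ### Counting coincidences among ratios. -/

section Counting

lemma card_le_of_pairwise_modEq {A : Finset ℕ} {L r : ℕ} (hA : ∀ x ∈ A, x < L)
    (h : ∀ x ∈ A, ∀ y ∈ A, x ≡ y [MOD r]) : A.card ≤ L / r + 1 := by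
  refine (Finset.card_le_card_of_injOn (t := Finset.range (L / r + 1)) (fun x => x / r) ?_ ?_).trans
    (by simp)
  · intro x hx
    simp only [Finset.coe_range, Set.mem_Iio, Nat.lt_add_one_iff]
    exact Nat.div_le_div_right (hA x hx).le
  · intro x hx y hy hxy
    have := h x hx y hy
    rw [← Nat.div_add_mod x r, ← Nat.div_add_mod y r, this]
    simp only at hxy
    rw [hxy]

lemma filter_dvd_Icc_eq_image {g : ℕ} (hg : 1 ≤ g) (Q : ℕ) :
    ((Finset.Icc 1 Q).filter fun q => g ∣ q) = (Finset.Icc 1 (Q / g)).image fun h => g * h := by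
  ext q
  simp only [Finset.mem_filter, Finset.mem_Icc, Finset.mem_image]
  constructor
  · rintro ⟨⟨h1, h2⟩, h, rfl⟩
    refine ⟨h, ⟨Nat.pos_of_ne_zero (by rintro rfl; simp at h1), ?_⟩, rfl⟩
    rw [Nat.le_div_iff_mul_le hg, mul_comm]
    exact h2
  · rintro ⟨h, ⟨h1, h2⟩, rfl⟩
    rw [Nat.le_div_iff_mul_le hg, mul_comm] at h2
    exact ⟨⟨Nat.mul_pos hg h1, h2⟩, dvd_mul_right _ _⟩

/-- Bounding the gcd by the sum of all common divisors `g` separates `q` from `r`; each `g` then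
contributes at most `g · (H/g) · (Q/g)`, where `H` is the harmonic sum. -/
lemma sum_gcd_div_le (Q : ℕ) :
    ∑ q ∈ Finset.Icc 1 Q, ∑ r ∈ Finset.Icc 1 Q, ((Nat.gcd q r : ℝ) / q) ≤
      Q * (∑ q ∈ Finset.Icc 1 Q, (q : ℝ)⁻¹) ^ 2 := by
  set H := ∑ q ∈ Finset.Icc 1 Q, (q : ℝ)⁻¹ with hH
  have h1 (g : ℕ) (hg : 1 ≤ g) : ∑ q ∈ (Finset.Icc 1 Q).filter (fun q => g ∣ q), (q : ℝ)⁻¹ ≤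
      (g : ℝ)⁻¹ * H := by
    rw [filter_dvd_Icc_eq_image hg, Finset.sum_image fun a _ b _ h => Nat.eq_of_mul_eq_mul_left hg h,
      hH, Finset.mul_sum]
    push_cast
    simp_rw [mul_inv]
    refine Finset.sum_le_sum_of_subset_of_nonneg
      (Finset.Icc_subset_Icc le_rfl (Nat.div_le_self _ _)) fun _ _ _ => by positivity
  have h2 (g : ℕ) (hg : 1 ≤ g) :
      (((Finset.Icc 1 Q).filter (fun q => g ∣ q)).card : ℝ) ≤ Q / g := by
    rw [filter_dvd_Icc_eq_image hg]
    refine le_trans ?_ (Nat.cast_div_le (m := Q) (n := g))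
    exact_mod_cast Finset.card_image_le.trans (by simp)
  have h3 (q : ℕ) (hq : q ∈ Finset.Icc 1 Q) (r : ℕ) :
      ((Nat.gcd q r : ℝ) / q) ≤ ∑ g ∈ Finset.Icc 1 Q,
        (g : ℝ) * ((if g ∣ q then (q : ℝ)⁻¹ else 0) * (if g ∣ r then 1 else 0)) := by
    have hq' := Finset.mem_Icc.1 hq
    have hmem : Nat.gcd q r ∈ Finset.Icc 1 Q := Finset.mem_Icc.2
      ⟨Nat.gcd_pos_of_pos_left _ hq'.1, (Nat.gcd_le_left _ hq'.1).trans hq'.2⟩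
    refine le_trans (le_of_eq ?_) (Finset.single_le_sum (fun g _ => by positivity) hmem)
    simp [Nat.gcd_dvd_left, Nat.gcd_dvd_right, div_eq_mul_inv]
  calc _ ≤ ∑ q ∈ Finset.Icc 1 Q, ∑ r ∈ Finset.Icc 1 Q, ∑ g ∈ Finset.Icc 1 Q,
        (g : ℝ) * ((if g ∣ q then (q : ℝ)⁻¹ else 0) * (if g ∣ r then 1 else 0)) :=
        Finset.sum_le_sum fun q hq => Finset.sum_le_sum fun r _ => h3 q hq r
    _ = ∑ g ∈ Finset.Icc 1 Q, (g : ℝ) *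
        ((∑ q ∈ (Finset.Icc 1 Q).filter (fun q => g ∣ q), (q : ℝ)⁻¹) *
          (((Finset.Icc 1 Q).filter (fun q => g ∣ q)).card : ℝ)) := by
        rw [Finset.sum_congr rfl fun q _ => Finset.sum_comm, Finset.sum_comm]
        refine Finset.sum_congr rfl fun g _ => ?_
        rw [Finset.card_eq_sum_ones, Finset.sum_filter, Finset.sum_filter]
        push_cast
        rw [Finset.sum_mul_sum, Finset.mul_sum]
        simp_rw [Finset.mul_sum]
    _ ≤ ∑ g ∈ Finset.Icc 1 Q, (g : ℝ) * (((g : ℝ)⁻¹ * H) * (Q / g)) := by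
        refine Finset.sum_le_sum fun g hg => ?_
        have hg1 := (Finset.mem_Icc.1 hg).1
        have hHnn : 0 ≤ H := Finset.sum_nonneg fun _ _ => by positivity
        gcongr
        · exact h1 g hg1
        · exact h2 g hg1
    _ = Q * H ^ 2 := by
        rw [pow_two, ← mul_assoc]
        nth_rw 3 [hH]
        rw [Finset.mul_sum]
        refine Finset.sum_congr rfl fun g hg => ?_
        have hg1 : (g : ℝ) ≠ 0 := by
          have := (Finset.mem_Icc.1 hg).1
          positivity
        field_simp

/-- The solutions of a linear equation `j₂ q - j₁ r = t` in a box. -/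
lemma card_linear_eq_le {L q r : ℕ} (hq : 1 ≤ q) (A : Finset (ℕ × ℕ)) (t : ℤ)
    (hA : ∀ x ∈ A, x.1 < L ∧ (x.2 * q - x.1 * r : ℤ) = t) :
    A.card ≤ L / (q / Nat.gcd q r) + 1 := by
  have hinj : Set.InjOn Prod.fst (A : Set (ℕ × ℕ)) := by
    rintro ⟨a, b⟩ hx ⟨a', b'⟩ hy (rfl : a = a')
    have h : (b * q : ℤ) = b' * q := by
      have h1 := (hA _ hx).2
      have h2 := (hA _ hy).2
      simp only at h1 h2
      linarith
    have : b = b' := by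
      have h' : b * q = b' * q := by exact_mod_cast h
      exact Nat.eq_of_mul_eq_mul_right hq h'
    rw [this]
  rw [← Finset.card_image_of_injOn hinj]
  refine card_le_of_pairwise_modEq ?_ ?_
  · intro x hx
    obtain ⟨y, hy, rfl⟩ := Finset.mem_image.1 hx
    exact (hA y hy).1
  · intro x hx x' hx'
    obtain ⟨y, hy, rfl⟩ := Finset.mem_image.1 hx
    obtain ⟨y', hy', rfl⟩ := Finset.mem_image.1 hx'
    have h : (y.1 * r : ℤ) ≡ y'.1 * r [ZMOD q] := by
      refine Int.ModEq.symm (Int.modEq_iff_dvd.2 ⟨y.2 - y'.2, ?_⟩)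
      have h1 := (hA _ hy).2
      have h2 := (hA _ hy').2
      linear_combination h2 - h1
    have h' : y.1 * r ≡ y'.1 * r [MOD q] := by
      rw [← Int.natCast_modEq_iff]
      push_cast
      exact h
    exact Nat.ModEq.cancel_right_div_gcd hq h'

variable {p : ℕ} [Fact p.Prime]

/-- The number of pairs `(j, q)` with `(c + j) / q = σ`. -/
noncomputable def ratioCount (c : ZMod p) (L Q : ℕ) (σ : ZMod p) : ℕ :=
  ((Finset.range L ×ˢ Finset.Icc 1 Q).filter fun t => (c + (t.1 : ZMod p)) / (t.2 : ZMod p) = σ).card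

/-- The condition fixes `j₂ q - j₁ r` mod `p`, and this integer lies in an interval of length `2LQ`.
The first factor bounds its possible values, the second the solutions of each resulting linear
equation. -/
lemma card_ratio_eq_le (c : ZMod p) {L Q q r : ℕ} (hq : q ∈ Finset.Icc 1 Q)
    (hr : r ∈ Finset.Icc 1 Q) :
    ((Finset.range L ×ˢ Finset.range L).filter fun x : ℕ × ℕ =>
      (c + (x.1 : ZMod p)) * r = (c + (x.2 : ZMod p)) * q).card ≤
      (2 * (L * Q) / p + 1) * (L / (q / Nat.gcd q r) + 1) := by
  classical
  set S := (Finset.range L ×ˢ Finset.range L).filter fun x : ℕ × ℕ =>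
      (c + (x.1 : ZMod p)) * r = (c + (x.2 : ZMod p)) * q with hS
  rw [Finset.mem_Icc] at hq hr
  -- Adding `L * Q` keeps the natural subtraction from truncating.
  let f : ℕ × ℕ → ℕ := fun x => x.2 * q + L * Q - x.1 * r
  have hb (x) (hx : x ∈ S) : x.1 < L ∧ x.2 < L ∧ x.2 * q < L * Q ∧ x.1 * r ≤ L * Q := by
    simp only [hS, Finset.mem_filter, Finset.mem_product, Finset.mem_range] at hx
    refine ⟨hx.1.1, hx.1.2, ?_, Nat.mul_le_mul hx.1.1.le hr.2⟩
    exact (Nat.mul_lt_mul_of_pos_right hx.1.2 hq.1).trans_le (Nat.mul_le_mul_left _ hq.2)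
  rw [mul_comm]
  refine (Finset.card_le_mul_card_image (f := f) S (L / (q / Nat.gcd q r) + 1) ?_).trans ?_
  · intro b _
    refine card_linear_eq_le hq.1 _ ((b : ℤ) - L * Q) fun x hx => ?_
    rw [Finset.mem_filter] at hx
    obtain ⟨h1, -, -, h4⟩ := hb x hx.1
    refine ⟨h1, ?_⟩
    rw [← hx.2]
    simp only [f]
    rw [Nat.cast_sub (by omega)]
    push_cast
    ring
  · refine Nat.mul_le_mul_left _ (card_le_of_pairwise_modEq ?_ ?_)
    · intro y hy
      obtain ⟨x, hx, rfl⟩ := Finset.mem_image.1 hy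
      obtain ⟨-, -, h3, -⟩ := hb x hx
      simp only [f]
      omega
    · have hval (x) (hx : x ∈ S) : ((f x : ℕ) : ZMod p) = c * (r - q) + L * Q := by
        obtain ⟨-, -, -, h4⟩ := hb x hx
        simp only [f]
        rw [Nat.cast_sub (by omega)]
        push_cast
        have := (Finset.mem_filter.1 hx).2
        linear_combination -this
      intro y hy y' hy'
      obtain ⟨x, hx, rfl⟩ := Finset.mem_image.1 hy
      obtain ⟨x', hx', rfl⟩ := Finset.mem_image.1 hy'
      rw [← ZMod.natCast_eq_natCast_iff, hval x hx, hval x' hx']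

lemma sum_ratioCount (c : ZMod p) (L Q : ℕ) : ∑ σ, ratioCount c L Q σ = L * Q := by
  simp only [ratioCount]
  rw [← Finset.card_eq_sum_card_fiberwise fun _ _ => Finset.mem_coe.2 (Finset.mem_univ _)]
  simp

lemma sum_ratioCount_sq_le (c : ZMod p) {L Q : ℕ} (hQp : Q < p) (hQL : Q ≤ L) :
    ∑ σ, (ratioCount c L Q σ : ℝ) ^ 2 ≤
      (2 * (L * Q) / p + 1) * (2 * (L * Q)) * (∑ q ∈ Finset.Icc 1 Q, (q : ℝ)⁻¹) ^ 2 := by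
  classical
  let T := Finset.range L ×ˢ Finset.Icc 1 Q
  let ρ : ℕ × ℕ → ZMod p := fun t => (c + (t.1 : ZMod p)) / (t.2 : ZMod p)
  let P (q r : ℕ) := (Finset.range L ×ˢ Finset.range L).filter fun x : ℕ × ℕ =>
      (c + (x.1 : ZMod p)) * r = (c + (x.2 : ZMod p)) * q
  have hcast (q : ℕ) (hq : q ∈ Finset.Icc 1 Q) : (q : ZMod p) ≠ 0 := by
    rw [Finset.mem_Icc] at hq
    rw [Ne, ZMod.natCast_eq_zero_iff]
    exact Nat.not_dvd_of_pos_of_lt hq.1 (by omega)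
  have h1 : ∑ σ, ratioCount c L Q σ ^ 2 ≤
      ∑ q ∈ Finset.Icc 1 Q, ∑ r ∈ Finset.Icc 1 Q, (P q r).card := by
    calc ∑ σ, ratioCount c L Q σ ^ 2 = ((T ×ˢ T).filter fun x => ρ x.1 = ρ x.2).card := by
          rw [Finset.card_eq_sum_card_fiberwise (f := fun x => ρ x.1) (t := Finset.univ)
            fun _ _ => Finset.mem_coe.2 (Finset.mem_univ _)]
          refine Finset.sum_congr rfl fun σ _ => ?_
          rw [pow_two, ratioCount, ← Finset.card_product]
          congr 1
          ext ⟨x, y⟩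
          simp only [Finset.mem_product, Finset.mem_filter, T, ρ]
          constructor
          · rintro ⟨⟨hx, rfl⟩, hy, h⟩
            exact ⟨⟨⟨hx, hy⟩, h.symm⟩, rfl⟩
          · rintro ⟨⟨⟨hx, hy⟩, h⟩, rfl⟩
            exact ⟨⟨hx, rfl⟩, hy, h.symm⟩
      _ ≤ (((Finset.Icc 1 Q) ×ˢ (Finset.Icc 1 Q)).sigma fun s => P s.1 s.2).card := by
          refine Finset.card_le_card_of_injOn
            (fun x => ⟨(x.1.2, x.2.2), (x.1.1, x.2.1)⟩) ?_ ?_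
          · rintro ⟨⟨j, q⟩, j', r⟩ hx
            simp only [Finset.coe_filter, Finset.mem_product, Set.mem_ofPred_eq, T, ρ] at hx
            obtain ⟨⟨⟨hj, hq⟩, hj', hr⟩, h⟩ := hx
            simp only [Finset.coe_sigma, Set.mem_sigma_iff, Finset.mem_coe, Finset.mem_product,
              Finset.mem_filter, P]
            refine ⟨⟨hq, hr⟩, ⟨hj, hj'⟩, ?_⟩
            rwa [div_eq_div_iff (hcast q hq) (hcast r hr)] at h
          · rintro ⟨⟨j, q⟩, j', r⟩ _ ⟨⟨i, s⟩, i', t⟩ _ h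
            simp only [Sigma.mk.injEq, Prod.mk.injEq, heq_eq_eq] at h ⊢
            tauto
      _ = _ := by rw [Finset.card_sigma, Finset.sum_product]
  have h2 : (∑ σ, (ratioCount c L Q σ : ℝ) ^ 2) ≤
      ∑ q ∈ Finset.Icc 1 Q, ∑ r ∈ Finset.Icc 1 Q, ((P q r).card : ℝ) := by exact_mod_cast h1
  refine h2.trans ?_
  have h3 (q : ℕ) (hq : q ∈ Finset.Icc 1 Q) (r : ℕ) (hr : r ∈ Finset.Icc 1 Q) :
      ((P q r).card : ℝ) ≤ (2 * (L * Q) / p + 1) * (2 * L) * ((Nat.gcd q r : ℝ) / q) := by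
    have hP : ((P q r).card : ℝ) ≤
        ((2 * (L * Q) / p + 1 : ℕ) : ℝ) * ((L / (q / Nat.gcd q r) + 1 : ℕ) : ℝ) := by
      exact_mod_cast card_ratio_eq_le c hq hr
    rw [Finset.mem_Icc] at hq
    have hg : 0 < Nat.gcd q r := Nat.gcd_pos_of_pos_left _ hq.1
    have e1 : ((2 * (L * Q) / p + 1 : ℕ) : ℝ) ≤ 2 * (L * Q) / p + 1 := by
      have := Nat.cast_div_le (α := ℝ) (m := 2 * (L * Q)) (n := p)
      push_cast at this ⊢
      linarith
    have e2 : ((L / (q / Nat.gcd q r) + 1 : ℕ) : ℝ) ≤ 2 * L * ((Nat.gcd q r : ℝ) / q) := by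
      have h := Nat.cast_div_le (α := ℝ) (m := L) (n := q / Nat.gcd q r)
      rw [Nat.cast_div (Nat.gcd_dvd_left q r) (by positivity), div_div_eq_mul_div] at h
      -- Here `Q ≤ L` is needed: it lets the `+ 1` be absorbed by doubling the main term.
      have h' : (1 : ℝ) ≤ L * (Nat.gcd q r : ℝ) / q := by
        rw [le_div_iff₀ (by exact_mod_cast hq.1), one_mul]
        have : q ≤ L * Nat.gcd q r := (hq.2.trans hQL).trans (Nat.le_mul_of_pos_right _ hg)
        exact_mod_cast this
      push_cast
      rw [mul_div_assoc] at h h'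
      linarith
    calc _ ≤ _ := hP
      _ ≤ (2 * (L * Q) / p + 1) * (2 * L * ((Nat.gcd q r : ℝ) / q)) := by gcongr
      _ = _ := by ring
  calc _ ≤ ∑ q ∈ Finset.Icc 1 Q, ∑ r ∈ Finset.Icc 1 Q,
        (2 * (L * Q) / p + 1) * (2 * L) * ((Nat.gcd q r : ℝ) / q) :=
        Finset.sum_le_sum fun q hq => Finset.sum_le_sum fun r hr => h3 q hq r hr
    _ = (2 * (L * Q) / p + 1) * (2 * L) *
        ∑ q ∈ Finset.Icc 1 Q, ∑ r ∈ Finset.Icc 1 Q, ((Nat.gcd q r : ℝ) / q) := by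
        simp_rw [← Finset.mul_sum]
    _ ≤ (2 * (L * Q) / p + 1) * (2 * L) * (Q * (∑ q ∈ Finset.Icc 1 Q, (q : ℝ)⁻¹) ^ 2) := by
        gcongr
        exact sum_gcd_div_le Q
    _ = _ := by ring

end Counting

/-! ### The moment bound with free parameters `Q` and `M`. -/

section MomentBound

lemma sum_mul_pow_le {ι : Type*} (s : Finset ι) (w x : ι → ℝ) (hw : ∀ i, 0 ≤ w i)
    (hx : ∀ i, 0 ≤ x i) {k : ℕ} (hk : 1 ≤ k) :
    (∑ i ∈ s, w i * x i) ^ k ≤ (∑ i ∈ s, w i) ^ (k - 1) * ∑ i ∈ s, w i * x i ^ k := by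
  set W := ∑ i ∈ s, w i with hW
  rcases eq_or_ne W 0 with h0 | h0
  · have h (i) (hi : i ∈ s) : w i = 0 :=
      (Finset.sum_eq_zero_iff_of_nonneg fun i _ => hw i).1 h0 i hi
    rw [Finset.sum_eq_zero fun i hi => by rw [h i hi, zero_mul], zero_pow (by omega)]
    have := Finset.sum_nonneg fun i (_ : i ∈ s) => mul_nonneg (hw i) (pow_nonneg (hx i) k)
    rw [h0]
    positivity
  · have hWpos : 0 < W := lt_of_le_of_ne (Finset.sum_nonneg fun i _ => hw i) h0.symm
    have := Real.pow_arith_mean_le_arith_mean_pow s (fun i => w i / W) x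
      (fun i _ => div_nonneg (hw i) hWpos.le)
      (by rw [← Finset.sum_div, ← hW, div_self h0]) (fun i _ => hx i) k
    simp_rw [div_mul_eq_mul_div] at this
    rw [← Finset.sum_div, ← Finset.sum_div, div_pow, div_le_div_iff₀ (by positivity) hWpos] at this
    have e : W ^ k = W ^ (k - 1) * W := by rw [← pow_succ, Nat.sub_add_cancel hk]
    rw [e] at this
    refine le_of_mul_le_mul_right (this.trans (le_of_eq ?_)) hWpos
    ring

/-- Jensen followed by Cauchy–Schwarz. The exponents are arranged so that only the first two moments
of the multiplicities `w` enter. -/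
lemma sum_mul_pow_two_mul_le {ι : Type*} (s : Finset ι) (w x : ι → ℝ) (hw : ∀ i, 0 ≤ w i)
    (hx : ∀ i, 0 ≤ x i) {k : ℕ} (hk : 1 ≤ k) :
    (∑ i ∈ s, w i * x i) ^ (2 * k) ≤
      (∑ i ∈ s, w i) ^ (2 * k - 2) * ((∑ i ∈ s, w i ^ 2) * ∑ i ∈ s, x i ^ (2 * k)) := by
  have h1 := sum_mul_pow_le s w x hw hx hk
  have h2 := Finset.sum_mul_sq_le_sq_mul_sq s w fun i => x i ^ k
  have h0 : 0 ≤ ∑ i ∈ s, w i * x i := Finset.sum_nonneg fun i _ => mul_nonneg (hw i) (hx i)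
  have hW : 0 ≤ ∑ i ∈ s, w i := Finset.sum_nonneg fun i _ => hw i
  simp_rw [← pow_mul, mul_comm k 2] at h2
  calc (∑ i ∈ s, w i * x i) ^ (2 * k) = ((∑ i ∈ s, w i * x i) ^ k) ^ 2 := by
        rw [← pow_mul, mul_comm]
    _ ≤ ((∑ i ∈ s, w i) ^ (k - 1) * ∑ i ∈ s, w i * x i ^ k) ^ 2 := by gcongr
    _ = (∑ i ∈ s, w i) ^ (2 * k - 2) * (∑ i ∈ s, w i * x i ^ k) ^ 2 := by
        rw [mul_pow, ← pow_mul]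
        congr 2
        omega
    _ ≤ _ := by gcongr

variable {p : ℕ} [Fact p.Prime]

/-- The substitution `c + j + q u = q (σ + u)` with `σ = (c + j) / q`. -/
lemma sum_norm_pow_progression (d k M : ℕ) (x : ZMod p) {q : ZMod p} (hq : q ≠ 0) :
    ∑ l : ZMod p, ‖∑ u : Fin M,
        (ZMod.stdAddChar (l * ((x + q * (u : ℕ)) ^ d)⁻¹) : ℂ)‖ ^ (2 * k) =
      p * ((energySolutions k fun u : Fin M => ((x / q + ((u : ℕ) : ZMod p)) ^ d)⁻¹).card : ℝ) := by
  rw [← sum_norm_pow_eq_card]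
  have hqd : (q ^ d)⁻¹ ≠ 0 := inv_ne_zero (pow_ne_zero _ hq)
  refine Fintype.sum_equiv (Equiv.mulRight₀ _ hqd) _ _ fun l => ?_
  congr 3
  ext u
  rw [Equiv.mulRight₀_apply, mul_assoc, ← mul_inv, ← mul_pow, mul_add, mul_div_cancel₀ _ hq]

/-- Minkowski separates the progressions `(j, q)`. Each has a moment depending only on its ratio
`σ`, so they are grouped with multiplicity `ratioCount`. -/
lemma sum_norm_pow_le_ratioCount {d k : ℕ} (hk : 1 ≤ k) (c : ZMod p) {N Q M : ℕ} (hN : N < p)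
    (hQ : 1 ≤ Q) (hM : 1 ≤ M) (hQM : Q * M ≤ N) (α : ℕ → ℂ) (hα : ∀ n ∈ Finset.Icc 1 N, ‖α n‖ ≤ 1) :
    ∑ l : ZMod p, ‖∑ n ∈ Finset.Icc 1 N,
        α n * ZMod.stdAddChar (l * ((c + n) ^ d)⁻¹)‖ ^ (2 * k) ≤
      ((Q * M : ℝ) ^ (2 * k))⁻¹ *
        (∑ σ, (ratioCount (c - (N : ZMod p)) (2 * N + 1) Q σ : ℝ) *
          (p * ((energySolutions k fun u : Fin M => ((σ + ((u : ℕ) : ZMod p)) ^ d)⁻¹).card : ℝ)) ^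
            (1 / ((2 * k : ℕ) : ℝ))) ^ (2 * k) := by
  classical
  refine (sum_norm_pow_shift_le k (fun x => (x ^ d)⁻¹) c hN hQ hM hQM α hα).trans ?_
  refine mul_le_mul_of_nonneg_left ?_ (by positivity)
  set T := Finset.range (2 * N + 1) ×ˢ Finset.Icc 1 Q with hT
  have hmink := minkowski_sum T (fun (j : ℕ × ℕ) (l : ZMod p) => ∑ u : Fin M,
    (ZMod.stdAddChar (l * ((c - N + j.1 + j.2 * (u : ℕ)) ^ d)⁻¹) : ℂ)) (m := 2 * k) (by omega)
  have hQM' : Q < p := ((Nat.le_mul_of_pos_right Q hM).trans hQM).trans_lt hN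
  have e : ∑ j ∈ T, (∑ l : ZMod p, ‖∑ u : Fin M,
      (ZMod.stdAddChar (l * ((c - N + j.1 + j.2 * (u : ℕ)) ^ d)⁻¹) : ℂ)‖ ^ (2 * k)) ^
        (1 / ((2 * k : ℕ) : ℝ)) =
      ∑ σ, (ratioCount (c - (N : ZMod p)) (2 * N + 1) Q σ : ℝ) *
          (p * ((energySolutions k fun u : Fin M => ((σ + ((u : ℕ) : ZMod p)) ^ d)⁻¹).card : ℝ)) ^
            (1 / ((2 * k : ℕ) : ℝ)) := by
    rw [← Finset.sum_fiberwise T fun t => (c - N + (t.1 : ZMod p)) / (t.2 : ZMod p)]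
    refine Finset.sum_congr rfl fun σ _ => ?_
    rw [ratioCount, ← nsmul_eq_mul, ← Finset.sum_const]
    refine Finset.sum_congr (by rw [hT]) fun t ht => ?_
    rw [Finset.mem_filter, Finset.mem_product, Finset.mem_Icc] at ht
    rw [sum_norm_pow_progression, ht.2]
    rw [Ne, ZMod.natCast_eq_zero_iff]
    exact Nat.not_dvd_of_pos_of_lt ht.1.2.1 (by omega)
  rw [e] at hmink
  have h0 : 0 ≤ ∑ l : ZMod p, ‖∑ j ∈ T, ∑ u : Fin M,
      (ZMod.stdAddChar (l * ((c - N + j.1 + j.2 * (u : ℕ)) ^ d)⁻¹) : ℂ)‖ ^ (2 * k) :=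
    Finset.sum_nonneg fun _ _ => by positivity
  calc _ = ((∑ l : ZMod p, ‖∑ j ∈ T, ∑ u : Fin M,
      (ZMod.stdAddChar (l * ((c - N + j.1 + j.2 * (u : ℕ)) ^ d)⁻¹) : ℂ)‖ ^ (2 * k)) ^
        (1 / ((2 * k : ℕ) : ℝ))) ^ (2 * k) := by
        rw [one_div, Real.rpow_inv_natCast_pow h0 (by omega)]
    _ ≤ _ := by gcongr

/-- With `mn = min(p, NQ)`, the factor `1/mn` from the second moment cancels the `mn` from the
energy sum, and all powers of `Q` cancel. -/
lemma moment_arithmetic {k : ℕ} (hk : 1 ≤ k) {N Q M P mn H K : ℝ} (hN : 0 < N) (hQ : 0 < Q)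
    (hM : 0 < M) (hP : 0 < P) (hmn : 0 < mn) (hK : 0 ≤ K) :
    ((Q * M) ^ (2 * k))⁻¹ * ((3 * (N * Q)) ^ (2 * k - 2) *
        ((7 * ((N * Q) / mn) * (6 * (N * Q)) * H ^ 2) * (P * (mn * M ^ k * K)))) ≤
      (3 ^ (2 * k) * 42 * K) * H ^ 2 * (P * (N ^ (2 * k) / M ^ k)) := by
  calc _ = ((Q * M) ^ (2 * k))⁻¹ * ((3 * (N * Q)) ^ (2 * k - 2) * (N * Q) ^ 2) *
          (42 * H ^ 2 * (P * (M ^ k * K))) := by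
        field_simp
        ring
    _ ≤ ((Q * M) ^ (2 * k))⁻¹ * ((3 * (N * Q)) ^ (2 * k)) *
          (42 * H ^ 2 * (P * (M ^ k * K))) := by
        have e : (3 * (N * Q)) ^ (2 * k) = (3 * (N * Q)) ^ (2 * k - 2) * (3 * (N * Q)) ^ 2 := by
          rw [← pow_add]
          congr 1
          omega
        rw [e]
        have : N * Q ≤ 3 * (N * Q) := by nlinarith [mul_pos hN hQ]
        gcongr
    _ = _ := by
        have e : M ^ (2 * k) = M ^ k * M ^ k := by rw [two_mul, pow_add]
        simp only [mul_pow]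
        rw [e]
        field_simp

lemma sum_norm_pow_le_of_parameters {d k : ℕ} (hd : 1 ≤ d) (hk : 1 ≤ k) (hkp : k < p) (c : ZMod p)
    {N Q M : ℕ} (hN : N < p) (hQ : 1 ≤ Q) (hM : 1 ≤ M) (hQM : Q * M ≤ N)
    {B : ℝ} (hB1 : (M : ℝ) ^ k ≤ B * p) (hB2 : (M : ℝ) ^ k ≤ B * (N * Q))
    (α : ℕ → ℂ) (hα : ∀ n ∈ Finset.Icc 1 N, ‖α n‖ ≤ 1) :
    ∑ l : ZMod p, ‖∑ n ∈ Finset.Icc 1 N,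
        α n * ZMod.stdAddChar (l * ((c + n) ^ d)⁻¹)‖ ^ (2 * k) ≤
      (3 ^ (2 * k) * 42 * (3 * k.factorial + (2 * k * d + 2 * k) * B)) *
        (∑ q ∈ Finset.Icc 1 Q, (q : ℝ)⁻¹) ^ 2 * (p * ((N : ℝ) ^ (2 * k) / (M : ℝ) ^ k)) := by
  classical
  refine (sum_norm_pow_le_ratioCount hk c hN hQ hM hQM α hα).trans ?_
  set H := ∑ q ∈ Finset.Icc 1 Q, (q : ℝ)⁻¹ with hH
  set w := ratioCount (c - (N : ZMod p)) (2 * N + 1) Q with hw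
  let E : ZMod p → ℕ := fun σ =>
    (energySolutions k fun u : Fin M => ((σ + ((u : ℕ) : ZMod p)) ^ d)⁻¹).card
  have hQN : Q ≤ N := (Nat.le_mul_of_pos_right Q hM).trans hQM
  have hMN : M ≤ N := (Nat.le_mul_of_pos_left M hQ).trans hQM
  have hp0 : (0 : ℝ) < p := by exact_mod_cast (Fact.out : p.Prime).pos
  have hN0 : (0 : ℝ) < N := by exact_mod_cast hQ.trans hQN
  have hQ0 : (0 : ℝ) < Q := by exact_mod_cast hQ
  have hM0 : (0 : ℝ) < M := by exact_mod_cast hM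
  -- Restricting to the support makes the diagonal energy cost `min(p, NQ)` shifts, up to a
  -- constant, instead of `p`.
  let S := Finset.univ.filter fun σ => w σ ≠ 0
  set D : ℝ := N * Q with hD
  have hD0 : 0 < D := by positivity
  set mn : ℝ := min p D with hmn
  have hmn0 : 0 < mn := lt_min hp0 hD0
  have hLQ : ((2 * N + 1 : ℕ) : ℝ) * Q ≤ 3 * D := by
    have : ((2 * N + 1 : ℕ) : ℝ) ≤ 3 * N := by exact_mod_cast (by omega : 2 * N + 1 ≤ 3 * N)
    calc _ ≤ 3 * (N : ℝ) * Q := by gcongr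
      _ = _ := by rw [hD]; ring
  have hsum : ∑ σ ∈ S, (w σ : ℝ) ≤ 3 * D := by
    refine (Finset.sum_le_sum_of_subset_of_nonneg (Finset.subset_univ _)
      fun _ _ _ => by positivity).trans (le_trans (le_of_eq ?_) hLQ)
    exact_mod_cast sum_ratioCount (c - (N : ZMod p)) (2 * N + 1) Q
  have hsq : ∑ σ ∈ S, (w σ : ℝ) ^ 2 ≤ 7 * (D / mn) * (6 * D) * H ^ 2 := by
    refine (Finset.sum_le_sum_of_subset_of_nonneg (Finset.subset_univ _)
      fun _ _ _ => by positivity).trans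
        ((sum_ratioCount_sq_le (c - (N : ZMod p)) (hQN.trans_lt hN) (by omega)).trans ?_)
    -- The `7` is `6 + 1`: `2N + 1 ≤ 3N` yields the `6`, and `1 ≤ D / mn` absorbs the added `1`.
    have h1 : 2 * (((2 * N + 1 : ℕ) : ℝ) * Q) / p + 1 ≤ 7 * (D / mn) := by
      have h2 : 2 * (((2 * N + 1 : ℕ) : ℝ) * Q) / p ≤ 6 * (D / mn) := by
        calc _ ≤ 2 * (3 * D) / p := by gcongr
          _ = 6 * (D / p) := by ring
          _ ≤ 6 * (D / mn) := by
            gcongr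
            exact min_le_left _ _
      have h3 : 1 ≤ D / mn := (one_le_div hmn0).2 (min_le_right _ _)
      linarith
    have h4 : 2 * (((2 * N + 1 : ℕ) : ℝ) * Q) ≤ 6 * D := by linarith
    gcongr
  have hcard : (S.card : ℝ) ≤ 3 * mn := by
    have h1 : (S.card : ℝ) ≤ p := by
      have := Finset.card_le_univ S
      rw [ZMod.card] at this
      exact_mod_cast this
    have h2 : (S.card : ℝ) ≤ 3 * D := by
      refine le_trans ?_ hsum
      rw [Finset.cast_card]
      refine Finset.sum_le_sum fun σ hσ => ?_
      exact_mod_cast Nat.one_le_iff_ne_zero.2 (Finset.mem_filter.1 hσ).2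
    rw [hmn]
    rcases min_choice (p : ℝ) D with h | h <;> rw [h] <;> linarith
  have hBmn : (M : ℝ) ^ k ≤ B * mn := by
    rw [hmn]
    rcases min_choice (p : ℝ) D with h | h <;> rw [h] <;> assumption
  have hE : ∑ σ ∈ S, (E σ : ℝ) ≤
      mn * (M : ℝ) ^ k * (3 * k.factorial + (2 * k * d + 2 * k) * B) := by
    have h1 : (∑ σ ∈ S, (E σ : ℝ)) ≤ S.card * (k.factorial * (M : ℝ) ^ k) +
        (2 * k * d + 2 * k) * (M : ℝ) ^ (2 * k) := by
      exact_mod_cast sum_card_energySolutions_le hd hkp (hMN.trans hN.le) S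
    refine h1.trans ?_
    calc _ ≤ 3 * mn * (k.factorial * (M : ℝ) ^ k) +
        (2 * k * d + 2 * k) * ((B * mn) * (M : ℝ) ^ k) := by
          rw [show (M : ℝ) ^ (2 * k) = (M : ℝ) ^ k * (M : ℝ) ^ k by rw [two_mul, pow_add]]
          gcongr
      _ = _ := by ring
  have hB0 : 0 ≤ B := by
    have h1 : 0 ≤ B * p := (by positivity : (0 : ℝ) ≤ (M : ℝ) ^ k).trans hB1
    exact nonneg_of_mul_nonneg_left h1 hp0
  have hsupp : ∑ σ, (w σ : ℝ) * (p * (E σ : ℝ)) ^ (1 / ((2 * k : ℕ) : ℝ)) =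
      ∑ σ ∈ S, (w σ : ℝ) * (p * (E σ : ℝ)) ^ (1 / ((2 * k : ℕ) : ℝ)) := by
    refine (Finset.sum_subset (Finset.subset_univ _) fun σ _ hσ => ?_).symm
    have : w σ = 0 := by simpa [S] using hσ
    rw [this, Nat.cast_zero, zero_mul]
  have hroot (σ : ZMod p) : ((p * (E σ : ℝ)) ^ (1 / ((2 * k : ℕ) : ℝ))) ^ (2 * k) = p * E σ := by
    rw [one_div, Real.rpow_inv_natCast_pow (by positivity) (by omega)]
  change ((Q * M : ℝ) ^ (2 * k))⁻¹ *
    (∑ σ, (w σ : ℝ) * (p * (E σ : ℝ)) ^ (1 / ((2 * k : ℕ) : ℝ))) ^ (2 * k) ≤ _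
  rw [hsupp]
  have hK : 0 ≤ 3 * (k.factorial : ℝ) + (2 * k * d + 2 * k) * B := by positivity
  have hH0 : 0 ≤ H ^ 2 := sq_nonneg H
  have hsum0 : 0 ≤ ∑ σ ∈ S, (w σ : ℝ) := Finset.sum_nonneg fun _ _ => Nat.cast_nonneg _
  have hE0 : 0 ≤ p * ∑ σ ∈ S, (E σ : ℝ) :=
    mul_nonneg hp0.le (Finset.sum_nonneg fun _ _ => Nat.cast_nonneg _)
  clear_value w E S H mn D
  generalize 3 * (k.factorial : ℝ) + (2 * k * d + 2 * k) * B = K at hE hK ⊢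
  have hhold := sum_mul_pow_two_mul_le S (fun σ => (w σ : ℝ))
    (fun σ => (p * (E σ : ℝ)) ^ (1 / ((2 * k : ℕ) : ℝ))) (fun _ => Nat.cast_nonneg _)
    (fun _ => Real.rpow_nonneg (by positivity) _) hk
  simp only [hroot] at hhold
  rw [← Finset.mul_sum] at hhold
  subst hD
  have hbound : (∑ σ ∈ S, (w σ : ℝ)) ^ (2 * k - 2) *
      ((∑ σ ∈ S, (w σ : ℝ) ^ 2) * (p * ∑ σ ∈ S, (E σ : ℝ))) ≤
      (3 * (N * Q)) ^ (2 * k - 2) * ((7 * ((N * Q) / mn) * (6 * (N * Q)) * H ^ 2) *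
        (p * (mn * (M : ℝ) ^ k * K))) := by
    refine mul_le_mul (pow_le_pow_left₀ hsum0 hsum _)
      (mul_le_mul hsq (mul_le_mul_of_nonneg_left hE hp0.le) hE0 ?_) ?_ ?_
    · positivity
    · exact mul_nonneg (Finset.sum_nonneg fun _ _ => sq_nonneg _) hE0
    · positivity
  exact (mul_le_mul_of_nonneg_left (hhold.trans hbound) (by positivity)).trans
    (moment_arithmetic hk hN0 hQ0 hM0 hp0 hmn0 hK)

end MomentBound

/-! ### Optimizing the length of the progressions. -/

section MomentFinal

variable {p : ℕ} [Fact p.Prime]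

/-- `M` is the ceiling of `min(N^(2/(k+1)), P^(1/k))`. This minimum is at least `1`, so rounding up
costs at most a factor `2`; `M ≤ N` because `2/(k+1) ≤ 1`. -/
lemma exists_shift_length {k N P : ℕ} (hk : 1 ≤ k) (hN : 1 ≤ N) (hP : 1 ≤ P) :
    ∃ M : ℕ, 1 ≤ M ∧ M ≤ N ∧ (M : ℝ) ^ k ≤ 2 ^ k * P ∧
      (M : ℝ) ^ (k + 1) ≤ 2 ^ (k + 1) * (N : ℝ) ^ 2 ∧
      min ((N : ℝ) ^ (2 * (k : ℝ) / (k + 1))) P ≤ (M : ℝ) ^ k := by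
  have hN' : (1 : ℝ) ≤ N := by exact_mod_cast hN
  have hP' : (1 : ℝ) ≤ P := by exact_mod_cast hP
  have hk' : (1 : ℝ) ≤ k := by exact_mod_cast hk
  set s : ℝ := (N : ℝ) ^ (2 / ((k : ℝ) + 1)) with hs
  set t : ℝ := (P : ℝ) ^ (1 / (k : ℝ)) with ht
  have hs1 : 1 ≤ s := Real.one_le_rpow hN' (by positivity)
  have ht1 : 1 ≤ t := Real.one_le_rpow hP' (by positivity)
  have hsk : s ^ (k + 1) = (N : ℝ) ^ 2 := by
    rw [hs, ← Real.rpow_natCast, ← Real.rpow_mul (by positivity), ← Real.rpow_natCast]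
    congr 1
    push_cast
    field_simp
  have hsk' : s ^ k = (N : ℝ) ^ (2 * (k : ℝ) / (k + 1)) := by
    rw [hs, ← Real.rpow_natCast, ← Real.rpow_mul (by positivity)]
    congr 1
    field_simp
  have htk : t ^ k = P := by
    rw [ht, one_div, Real.rpow_inv_natCast_pow (by positivity) (by omega)]
  have hx1 : 1 ≤ min s t := le_min hs1 ht1
  have hM : (⌈min s t⌉₊ : ℝ) ≤ 2 * min s t := by
    have := Nat.ceil_lt_add_one (zero_le_one.trans hx1)
    linarith
  refine ⟨⌈min s t⌉₊, Nat.one_le_ceil_iff.2 (by linarith), ?_, ?_, ?_, ?_⟩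
  · rw [Nat.ceil_le]
    refine (min_le_left _ _).trans ?_
    calc s ≤ (N : ℝ) ^ (1 : ℝ) := by
          refine Real.rpow_le_rpow_of_exponent_le hN' ?_
          rw [div_le_one (by positivity)]
          linarith
      _ = N := Real.rpow_one _
  · rw [← htk, ← mul_pow]
    gcongr
    exact hM.trans (by gcongr; exact min_le_right _ _)
  · rw [← hsk, ← mul_pow]
    gcongr
    exact hM.trans (by gcongr; exact min_le_left _ _)
  · rw [← hsk', ← htk]
    have h : (min s t) ^ k ≤ (⌈min s t⌉₊ : ℝ) ^ k := by
      gcongr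
      exact Nat.le_ceil _
    refine le_trans ?_ h
    rcases min_choice s t with h | h <;> rw [h]
    · exact min_le_left _ _
    · exact min_le_right _ _

lemma sum_inv_Icc_le (n : ℕ) : ∑ q ∈ Finset.Icc 1 n, (q : ℝ)⁻¹ ≤ 1 + Real.log n := by
  have := harmonic_le_one_add_log n
  rw [harmonic_eq_sum_Icc] at this
  push_cast at this
  exact this

/-- The constant in `sum_norm_pow_reciprocal_le`. -/
noncomputable def momentConst (d k : ℕ) : ℝ :=
  3 ^ (2 * k) * 42 * (3 * k.factorial + (2 * k * d + 2 * k) * 2 ^ (k + 2))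

lemma one_le_momentConst (d k : ℕ) : 1 ≤ momentConst d k := by
  have h1 : (1 : ℝ) ≤ 3 ^ (2 * k) := one_le_pow₀ (by norm_num)
  have h2 : (1 : ℝ) ≤ k.factorial := by exact_mod_cast Nat.factorial_pos k
  have h3 : (0 : ℝ) ≤ (2 * k * d + 2 * k) * 2 ^ (k + 2) := by positivity
  rw [momentConst]
  nlinarith

/-- The moment of an incomplete exponential sum with powers of reciprocals. -/
lemma sum_norm_pow_reciprocal_le {d k : ℕ} (hd : 1 ≤ d) (hk : 1 ≤ k) (hkp : k < p) (c : ZMod p)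
    {N : ℕ} (hN1 : 1 ≤ N) (hN : N < p) (α : ℕ → ℂ) (hα : ∀ n ∈ Finset.Icc 1 N, ‖α n‖ ≤ 1) :
    ∑ l : ZMod p, ‖∑ n ∈ Finset.Icc 1 N,
        α n * ZMod.stdAddChar (l * ((c + n) ^ d)⁻¹)‖ ^ (2 * k) ≤
      (momentConst d k * (1 + Real.log p) *
        ((N : ℝ) + (N : ℝ) ^ ((k : ℝ) / ((k : ℝ) + 1)) * (p : ℝ) ^ (1 / (2 * (k : ℝ))))) ^
          (2 * k) := by
  have hp1 : 1 ≤ p := (Fact.out : p.Prime).one_lt.le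
  have hp1' : (1 : ℝ) ≤ p := by exact_mod_cast hp1
  have hN1' : (1 : ℝ) ≤ N := by exact_mod_cast hN1
  have hk' : (1 : ℝ) ≤ k := by exact_mod_cast hk
  obtain ⟨M, hM1, hMN, hMp, hMN2, hMmin⟩ := exists_shift_length hk hN1 hp1
  have hM0 : (0 : ℝ) < M := by exact_mod_cast hM1
  set Q := N / M with hQ
  have hQ1 : 1 ≤ Q := Nat.div_pos hMN hM1
  have hQM : Q * M ≤ N := Nat.div_mul_le_self N M
  have hN2 : N ≤ 2 * (Q * M) := by
    have h1 := Nat.lt_div_mul_add (a := N) hM1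
    have h2 : 1 * M ≤ Q * M := Nat.mul_le_mul_right M hQ1
    rw [← hQ] at h1
    omega
  -- From `M^(k+1) ≪ N²` and `N ≤ 2QM`, dividing by `M`. The two powers of two combine into the `2 ^
  -- (k + 2)` of `momentConst`.
  have hB2 : (M : ℝ) ^ k ≤ 2 ^ (k + 2) * (N * Q) := by
    have h1 : (N : ℝ) ≤ 2 * (Q * M) := by exact_mod_cast hN2
    refine le_of_mul_le_mul_right ?_ hM0
    calc (M : ℝ) ^ k * M = (M : ℝ) ^ (k + 1) := by rw [pow_succ]
      _ ≤ 2 ^ (k + 1) * (N * N) := by rw [← pow_two]; exact hMN2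
      _ ≤ 2 ^ (k + 1) * (N * (2 * (Q * M))) := by gcongr
      _ = _ := by ring
  have hB1 : (M : ℝ) ^ k ≤ 2 ^ (k + 2) * p := by
    refine hMp.trans ?_
    gcongr
    · norm_num
    · omega
  refine (sum_norm_pow_le_of_parameters hd hk hkp c hN hQ1 hM1 hQM hB1 hB2 α hα).trans ?_
  rw [← momentConst]
  have hL1 : 1 ≤ 1 + Real.log p := by
    have := Real.log_nonneg hp1'
    linarith
  have hH : ∑ q ∈ Finset.Icc 1 Q, (q : ℝ)⁻¹ ≤ 1 + Real.log p := by
    refine (sum_inv_Icc_le Q).trans ?_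
    gcongr
    exact ((Nat.le_mul_of_pos_right Q hM1).trans hQM).trans hN.le
  have hC := one_le_momentConst d k
  set Y : ℝ := (N : ℝ) ^ ((k : ℝ) / ((k : ℝ) + 1)) * (p : ℝ) ^ (1 / (2 * (k : ℝ))) with hY
  have hYpow : Y ^ (2 * k) = p * ((N : ℝ) ^ (2 * k) / (N : ℝ) ^ (2 * (k : ℝ) / (k + 1))) := by
    have e1 : ((p : ℝ) ^ (1 / (2 * (k : ℝ)))) ^ (2 * k) = p := by
      have : (1 / (2 * (k : ℝ))) = (((2 * k : ℕ) : ℝ))⁻¹ := by push_cast; rw [one_div]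
      rw [this, Real.rpow_inv_natCast_pow (by positivity) (by omega)]
    have e2 : ((N : ℝ) ^ ((k : ℝ) / ((k : ℝ) + 1))) ^ (2 * k) =
        (N : ℝ) ^ (2 * k) / (N : ℝ) ^ (2 * (k : ℝ) / (k + 1)) := by
      rw [← Real.rpow_natCast, ← Real.rpow_mul (by positivity), ← Real.rpow_natCast (N : ℝ),
        ← Real.rpow_sub (by positivity)]
      congr 1
      push_cast
      field_simp
      ring
    rw [hY, mul_pow, e1, e2, mul_comm]
  have hmain : p * ((N : ℝ) ^ (2 * k) / (M : ℝ) ^ k) ≤ ((N : ℝ) + Y) ^ (2 * k) := by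
    -- If `N^(2k/(k+1))` is the bound for `M^k`, the value is at most `Y^(2k)`; if it is `p`, at
    -- most `N^(2k)`.
    have h1 : p * ((N : ℝ) ^ (2 * k) / (M : ℝ) ^ k) ≤ max (Y ^ (2 * k)) ((N : ℝ) ^ (2 * k)) := by
      rw [hYpow]
      rcases min_le_iff.1 hMmin with h | h
      · refine le_trans ?_ (le_max_left _ _)
        gcongr
      · refine le_trans ?_ (le_max_right _ _)
        rw [← mul_div_assoc, div_le_iff₀ (by positivity), mul_comm]
        gcongr
    refine h1.trans (max_le ?_ ?_)
    · gcongr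
      linarith
    · gcongr
      have : 0 ≤ Y := by positivity
      linarith
  calc _ ≤ (momentConst d k) ^ (2 * k) * (1 + Real.log p) ^ (2 * k) * ((N : ℝ) + Y) ^ (2 * k) := by
        have h1 : momentConst d k ≤ (momentConst d k) ^ (2 * k) := le_self_pow₀ hC (by omega)
        have h2 : (∑ q ∈ Finset.Icc 1 Q, (q : ℝ)⁻¹) ^ 2 ≤ (1 + Real.log p) ^ (2 * k) := by
          refine (pow_le_pow_left₀ (Finset.sum_nonneg fun _ _ => by positivity) hH 2).trans ?_
          exact pow_le_pow_right₀ hL1 (by omega)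
        gcongr
    _ = _ := by rw [mul_pow, mul_pow]

end MomentFinal

/-! ### Fourier completion of intervals. -/

section Completion

variable {p : ℕ} [Fact p.Prime]

/-- A majorant for the normalized Fourier coefficients of an interval. -/
noncomputable def intervalMajorant (h : ZMod p) : ℝ :=
  (if h = 0 then 1 else 0) + ((h.val : ℝ)⁻¹ + ((p - h.val : ℕ) : ℝ)⁻¹)

lemma intervalMajorant_nonneg (h : ZMod p) : 0 ≤ intervalMajorant h := by
  rw [intervalMajorant]
  split_ifs <;> positivity

lemma sum_intervalMajorant_le : ∑ h : ZMod p, intervalMajorant h ≤ 3 * (1 + Real.log p) := by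
  have hp1 : 1 ≤ p := (Fact.out : p.Prime).one_lt.le
  have hval (f : ℕ → ℝ) : ∑ h : ZMod p, f h.val = ∑ n ∈ Finset.range p, f n := by
    refine Finset.sum_bij (fun h _ => h.val) (fun h _ => Finset.mem_range.2 (ZMod.val_lt h))
      (fun _ _ _ _ h => ZMod.val_injective p h) (fun n hn => ?_) fun _ _ => rfl
    exact ⟨n, Finset.mem_univ _, ZMod.val_cast_of_lt (Finset.mem_range.1 hn)⟩
  have h1 : ∑ n ∈ Finset.range p, (n : ℝ)⁻¹ ≤ 1 + Real.log p := by
    refine le_trans ?_ (sum_inv_Icc_le p)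
    -- The term `n = 0` is `0⁻¹ = 0` and drops out.
    rw [← Finset.sum_filter_ne_zero]
    refine Finset.sum_le_sum_of_subset_of_nonneg (fun n hn => ?_) fun _ _ _ => by positivity
    simp only [Finset.mem_filter, Finset.mem_range, ne_eq, inv_eq_zero, Nat.cast_eq_zero] at hn
    exact Finset.mem_Icc.2 ⟨by omega, by omega⟩
  have h2 : ∑ n ∈ Finset.range p, ((p - n : ℕ) : ℝ)⁻¹ ≤ 1 + Real.log p := by
    refine le_trans (le_of_eq ?_) (sum_inv_Icc_le p)
    refine Finset.sum_bij (fun n _ => p - n) ?_ ?_ ?_ fun _ _ => rfl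
    · intro n hn
      rw [Finset.mem_range] at hn
      exact Finset.mem_Icc.2 ⟨by omega, by omega⟩
    · intro n hn m hm h
      rw [Finset.mem_range] at hn hm
      omega
    · intro m hm
      rw [Finset.mem_Icc] at hm
      exact ⟨p - m, Finset.mem_range.2 (by omega), by omega⟩
  simp only [intervalMajorant]
  rw [Finset.sum_add_distrib, Finset.sum_add_distrib, hval fun n => (n : ℝ)⁻¹,
    hval fun n => ((p - n : ℕ) : ℝ)⁻¹]
  have h3 : ∑ h : ZMod p, (if h = 0 then (1 : ℝ) else 0) = 1 := by simp
  have h4 : 0 ≤ Real.log p := Real.log_nonneg (by exact_mod_cast hp1)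
  rw [h3]
  linarith

/-- The norm is `2 |sin(π v / p)|`, and Jordan's inequality applies to whichever of `v`, `p - v` is
at most `p / 2`. Keeping both reciprocals makes the bound uniform in `h`. -/
lemma two_div_norm_stdAddChar_sub_one_le {h : ZMod p} (hh : h ≠ 0) :
    2 / ‖(ZMod.stdAddChar h : ℂ) - 1‖ ≤ p * ((h.val : ℝ)⁻¹ + ((p - h.val : ℕ) : ℝ)⁻¹) := by
  set v := h.val with hv
  have hvp : v < p := ZMod.val_lt h
  have hv0 : 0 < v := Nat.pos_of_ne_zero fun h0 => hh ((ZMod.val_eq_zero h).1 h0)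
  have hv0' : (0 : ℝ) < v := by exact_mod_cast hv0
  have hp0 : (0 : ℝ) < p := by exact_mod_cast (hv0.trans hvp)
  have hpv : ((p - v : ℕ) : ℝ) = p - v := Nat.cast_sub hvp.le
  have hpv0 : (0 : ℝ) < p - v := by
    rw [sub_pos]
    exact_mod_cast hvp
  have hnorm : ‖(ZMod.stdAddChar h : ℂ) - 1‖ = 2 * |Real.sin (Real.pi * v / p)| := by
    have e : (ZMod.stdAddChar h : ℂ) = Complex.exp (Complex.I * ((2 * Real.pi * v / p : ℝ) : ℂ)) := by
      have h1 : h = (((v : ℤ)) : ZMod p) := by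
        rw [hv]
        simp
      rw [h1, ZMod.stdAddChar_coe]
      congr 1
      push_cast
      ring
    rw [e, Complex.norm_exp_I_mul_ofReal_sub_one, norm_mul, Real.norm_eq_abs, Real.norm_eq_abs,
      abs_of_pos (two_pos)]
    congr 3
    ring
  have hpi := Real.pi_pos
  have hlow (x : ℝ) (hx0 : 0 < x) (hx : x ≤ p / 2)
      (hsin : Real.sin (Real.pi * v / p) = Real.sin (Real.pi * x / p)) :
      2 / ‖(ZMod.stdAddChar h : ℂ) - 1‖ ≤ p * x⁻¹ := by
    have h1 := Real.mul_le_sin (x := Real.pi * x / p) (by positivity) (by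
      rw [div_le_div_iff₀ hp0 two_pos]
      nlinarith)
    have h2 : 2 / Real.pi * (Real.pi * x / p) = 2 * x / p := by field_simp
    rw [h2] at h1
    rw [hnorm, hsin, ← div_eq_mul_inv, div_le_div_iff₀ ?_ hx0]
    · have h3 := le_abs_self (Real.sin (Real.pi * x / p))
      have h4 : 2 * x ≤ |Real.sin (Real.pi * x / p)| * p := by
        rw [div_le_iff₀ hp0] at h1
        nlinarith
      nlinarith
    · have h3 := le_abs_self (Real.sin (Real.pi * x / p))
      have h4 : 0 < 2 * x / p := by positivity
      linarith
  rw [hpv, mul_add]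
  rcases le_total (v : ℝ) (p / 2) with hle | hle
  · have := hlow v hv0' hle rfl
    have : 0 ≤ (p : ℝ) * ((p : ℝ) - v)⁻¹ := by positivity
    linarith
  · have := hlow (p - v) hpv0 (by linarith) (by
      rw [← Real.sin_pi_sub]
      congr 1
      field_simp)
    have : 0 ≤ (p : ℝ) * (v : ℝ)⁻¹ := by positivity
    linarith

lemma norm_stdAddChar (x : ZMod p) : ‖(ZMod.stdAddChar x : ℂ)‖ = 1 :=
  AddChar.norm_apply _ _

lemma stdAddChar_ne_one {h : ZMod p} (hh : h ≠ 0) : (ZMod.stdAddChar h : ℂ) ≠ 1 := by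
  rw [← AddChar.map_zero_eq_one (ZMod.stdAddChar (N := p)), Ne, ZMod.injective_stdAddChar.eq_iff]
  exact hh

/-- A geometric progression for `h ≠ 0`, the trivial bound for `h = 0`. The bound does not involve
the endpoints, which may therefore vary with `v`. -/
lemma norm_sum_interval_le (h : ZMod p) {A B U : ℕ} (hA : 1 ≤ A) (hB : B ≤ U) (hU : U < p) :
    ‖∑ w ∈ Finset.Icc A B, (ZMod.stdAddChar (-(h * (w : ZMod p))) : ℂ)‖ ≤ p * intervalMajorant h := by
  rw [intervalMajorant]
  split_ifs with hh
  · subst hh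
    have h1 : ((Finset.Icc A B).card : ℝ) ≤ p := by
      rw [Nat.card_Icc]
      exact_mod_cast (by omega : B + 1 - A ≤ p)
    have h2 : (0 : ℝ) ≤ p * (((0 : ZMod p).val : ℝ)⁻¹ + ((p - (0 : ZMod p).val : ℕ) : ℝ)⁻¹) := by
      positivity
    simp only [zero_mul, neg_zero, AddChar.map_zero_eq_one, Finset.sum_const, nsmul_eq_mul, mul_one,
      Complex.norm_natCast]
    linarith
  · rw [zero_add]
    rcases lt_or_ge B A with hBA | hAB
    · rw [Finset.Icc_eq_empty (by omega), Finset.sum_empty, norm_zero]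
      positivity
    refine le_trans ?_ (two_div_norm_stdAddChar_sub_one_le hh)
    rw [← RCLike.norm_conj, map_sum]
    simp_rw [conj_stdAddChar, neg_neg]
    set z : ℂ := ZMod.stdAddChar h with hz
    have e (w : ℕ) : (ZMod.stdAddChar (h * (w : ZMod p)) : ℂ) = z ^ w := by
      rw [hz, ← AddChar.map_nsmul_eq_pow, nsmul_eq_mul, mul_comm]
    simp_rw [e]
    have hz1 : z ≠ 1 := stdAddChar_ne_one hh
    rw [← Finset.Ico_add_one_right_eq_Icc, geom_sum_Ico hz1 (by omega), norm_div]
    gcongr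
    refine (norm_sub_le _ _).trans ?_
    rw [norm_pow, norm_pow, hz, norm_stdAddChar]
    norm_num

/-- Fourier expansion of the indicator function of an interval. -/
lemma indicator_interval_eq {A B u : ℕ} (hB : B < p) (hu : u < p) :
    (if u ∈ Finset.Icc A B then (1 : ℂ) else 0) =
      (p : ℂ)⁻¹ * ∑ h : ZMod p, (∑ w ∈ Finset.Icc A B, (ZMod.stdAddChar (-(h * (w : ZMod p))) : ℂ)) *
        ZMod.stdAddChar (h * (u : ZMod p)) := by
  have hp0 : (p : ℂ) ≠ 0 := Nat.cast_ne_zero.2 (Fact.out : p.Prime).ne_zero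
  have e (w : ℕ) (hw : w ∈ Finset.Icc A B) :
      ∑ h : ZMod p, (ZMod.stdAddChar (-(h * (w : ZMod p))) : ℂ) * ZMod.stdAddChar (h * (u : ZMod p)) =
        if u = w then (p : ℂ) else 0 := by
    rw [Finset.mem_Icc] at hw
    simp_rw [← AddChar.map_add_eq_mul]
    have h1 (h : ZMod p) : -(h * (w : ZMod p)) + h * (u : ZMod p) = h * ((u : ZMod p) - w) := by ring
    simp_rw [h1]
    rw [AddChar.sum_mulShift _ (ZMod.isPrimitive_stdAddChar p), ZMod.card]
    have h2 : (u : ZMod p) - w = 0 ↔ u = w := by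
      rw [sub_eq_zero, ZMod.natCast_eq_natCast_iff', Nat.mod_eq_of_lt hu,
        Nat.mod_eq_of_lt (by omega)]
    simp only [h2]
    split_ifs <;> simp
  simp_rw [Finset.sum_mul]
  rw [Finset.sum_comm, Finset.sum_congr rfl e, Finset.sum_ite_eq]
  split_ifs
  · rw [inv_mul_cancel₀ hp0]
  · rw [mul_zero]

/-- A convex section of the integers `1, …, U` is an interval. -/
lemma exists_section_eq_Icc {𝓒 : Set (ℝ × ℝ)} (h𝓒 : Convex ℝ 𝓒) (U v : ℕ) :
    ∃ A B : ℕ, 1 ≤ A ∧ B ≤ U ∧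
      ∀ u ∈ Finset.Icc 1 U, (((u : ℝ), (v : ℝ)) ∈ 𝓒 ↔ u ∈ Finset.Icc A B) := by
  classical
  set S := (Finset.Icc 1 U).filter fun u : ℕ => ((u : ℝ), (v : ℝ)) ∈ 𝓒 with hS
  rcases S.eq_empty_or_nonempty with h | h
  -- An empty section is the empty interval `[1, 0]`.
  · refine ⟨1, 0, le_rfl, Nat.zero_le _, fun u hu => ⟨fun hc => ?_, fun hc => ?_⟩⟩
    · have : u ∈ S := Finset.mem_filter.2 ⟨hu, hc⟩
      simp [h] at this
    · simp at hc
  · have h1 := Finset.mem_filter.1 (S.min'_mem h)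
    have h2 := Finset.mem_filter.1 (S.max'_mem h)
    refine ⟨S.min' h, S.max' h, (Finset.mem_Icc.1 h1.1).1, (Finset.mem_Icc.1 h2.1).2,
      fun u hu => ⟨fun hc => ?_, fun hc => ?_⟩⟩
    · have : u ∈ S := Finset.mem_filter.2 ⟨hu, hc⟩
      exact Finset.mem_Icc.2 ⟨S.min'_le _ this, S.le_max' _ this⟩
    · rw [Finset.mem_Icc] at hc
      have hpre : Convex ℝ ((fun x : ℝ => (x, (v : ℝ))) ⁻¹' 𝓒) := by
        intro x hx y hy s t hs ht hst
        have := h𝓒 hx hy hs ht hst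
        have e : s • (x, (v : ℝ)) + t • (y, (v : ℝ)) = (s • x + t • y, (v : ℝ)) := by
          ext
          · simp
          · simp [← add_mul, hst]
        rw [e] at this
        exact this
      exact hpre.ordConnected.out h1.2 h2.2 ⟨by exact_mod_cast hc.1, by exact_mod_cast hc.2⟩

end Completion

/-! ### From moments to the bilinear sum. -/

section Bilinear

variable {p : ℕ} [Fact p.Prime]

/-- Hölder in `v` with exponent `2k`, after which nonnegativity allows the sum over the distinct
residues `v ≤ V < p` to be extended to all of `ZMod p`. -/
lemma sum_norm_linPow_le {d k : ℕ} (hd : 1 ≤ d) (hk : 1 ≤ k) (hkp : k < p) {a b : ZMod p}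
    (ha : a ≠ 0) {U V : ℕ} (hU1 : 1 ≤ U) (hU : U < p) (hV : V < p) (α : ℕ → ℂ)
    (hα : ∀ n ∈ Finset.Icc 1 U, ‖α n‖ ≤ 1) :
    ∑ v ∈ Finset.Icc 1 V, ‖∑ u ∈ Finset.Icc 1 U,
        α u * ZMod.stdAddChar ((v : ZMod p) / (a * (u : ZMod p) + b) ^ d)‖ ≤
      (V : ℝ) ^ (1 - 1 / (2 * (k : ℝ))) * (momentConst d k * (1 + Real.log p) *
        ((U : ℝ) + (U : ℝ) ^ ((k : ℝ) / ((k : ℝ) + 1)) * (p : ℝ) ^ (1 / (2 * (k : ℝ))))) := by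
  set F : ZMod p → ℝ := fun l => ‖∑ u ∈ Finset.Icc 1 U,
        α u * ZMod.stdAddChar (l / (a * (u : ZMod p) + b) ^ d)‖ with hF
  have hk' : (1 : ℝ) ≤ k := by exact_mod_cast hk
  have hp1 : (1 : ℝ) ≤ p := by exact_mod_cast (Fact.out : p.Prime).one_lt.le
  set R : ℝ := momentConst d k * (1 + Real.log p) *
        ((U : ℝ) + (U : ℝ) ^ ((k : ℝ) / ((k : ℝ) + 1)) * (p : ℝ) ^ (1 / (2 * (k : ℝ)))) with hR
  have hR0 : 0 ≤ R := by
    have h1 := one_le_momentConst d k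
    have h2 := Real.log_nonneg hp1
    positivity
  have hmom : ∑ l, F l ^ (2 * k) ≤ R ^ (2 * k) := by
    refine le_trans (le_of_eq ?_) (sum_norm_pow_reciprocal_le hd hk hkp (b / a) hU1 hU α hα)
    -- Since `a u + b = a (b / a + u)`, the factor `a⁻ᵈ` is absorbed by a change of the variable
    -- `l`.
    refine Fintype.sum_equiv (Equiv.mulRight₀ _ (inv_ne_zero (pow_ne_zero d ha))) _ _ fun l => ?_
    simp only [hF]
    congr 2
    refine Finset.sum_congr rfl fun u _ => ?_
    congr 2
    rw [Equiv.mulRight₀_apply, mul_assoc, ← mul_inv, ← mul_pow, div_eq_mul_inv]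
    congr 3
    field_simp
    ring
  have hres : ∑ v ∈ Finset.Icc 1 V, F v ^ (2 * k) ≤ ∑ l, F l ^ (2 * k) := by
    classical
    rw [← Finset.sum_image (f := fun l : ZMod p => F l ^ (2 * k)) (g := fun v : ℕ => (v : ZMod p))]
    · exact Finset.sum_le_sum_of_subset_of_nonneg (Finset.subset_univ _)
        fun _ _ _ => pow_nonneg (norm_nonneg _) _
    · intro v hv w hw h
      simp only [Finset.coe_Icc, Set.mem_Icc] at hv hw
      simp only at h
      rwa [ZMod.natCast_eq_natCast_iff', Nat.mod_eq_of_lt (by omega),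
        Nat.mod_eq_of_lt (by omega)] at h
  have hhold := Real.inner_le_weight_mul_Lp_of_nonneg (Finset.Icc 1 V) (p := ((2 * k : ℕ) : ℝ))
    (by exact_mod_cast (by omega : 1 ≤ 2 * k)) (fun _ => 1) (fun v : ℕ => F v) (fun _ => zero_le_one)
    (fun _ => norm_nonneg _)
  simp only [one_mul, Real.rpow_natCast, Finset.sum_const, Nat.card_Icc, Nat.add_sub_cancel,
    nsmul_eq_mul, mul_one] at hhold
  refine hhold.trans ?_
  have e : (((2 * k : ℕ) : ℝ))⁻¹ = 1 / (2 * (k : ℝ)) := by push_cast; rw [one_div]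
  rw [← e]
  refine mul_le_mul_of_nonneg_left ?_ (by positivity)
  refine (Real.rpow_le_rpow (Finset.sum_nonneg fun _ _ => pow_nonneg (norm_nonneg _) _)
    (hres.trans hmom) (by positivity)).trans ?_
  rw [Real.pow_rpow_inv_natCast hR0 (by omega)]

/-- Completion decouples the `v`-dependent interval from the inner sum. Each frequency `h` gives a
full sum over `u` with twisted weights, bounded uniformly in `h`, so only the mass of
`intervalMajorant` is lost. -/
lemma norm_bilinearExpSumLinPow_le {d k : ℕ} (hd : 1 ≤ d) (hk : 1 ≤ k) (hkp : k < p)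
    {a b : ZMod p} (ha : a ≠ 0) {U V : ℕ} (hU1 : 1 ≤ U) (hU : U < p) (hV : V < p)
    {𝓒 : Set (ℝ × ℝ)} (h𝓒 : Convex ℝ 𝓒) (α β : ℕ → ℂ) (hα : ∀ u ∈ Finset.Icc 1 U, ‖α u‖ ≤ 1)
    (hβ : ∀ v ∈ Finset.Icc 1 V, ‖β v‖ ≤ 1) :
    ‖bilinearExpSumLinPow p a b d U V α β 𝓒‖ ≤ 3 * (1 + Real.log p) *
      ((V : ℝ) ^ (1 - 1 / (2 * (k : ℝ))) * (momentConst d k * (1 + Real.log p) *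
        ((U : ℝ) + (U : ℝ) ^ ((k : ℝ) / ((k : ℝ) + 1)) * (p : ℝ) ^ (1 / (2 * (k : ℝ)))))) := by
  classical
  choose A B hA hB hAB using exists_section_eq_Icc h𝓒 U
  have hp0 : (p : ℂ) ≠ 0 := Nat.cast_ne_zero.2 (Fact.out : p.Prime).ne_zero
  have hp0' : (0 : ℝ) < p := Nat.cast_pos.2 (Fact.out : p.Prime).pos
  -- The weight vanishes where `a u + b = 0`, so the default value of the division there contributes
  -- nothing.
  let α' : ZMod p → ℕ → ℂ := fun h u =>
    (if (a * (u : ZMod p) + b) ^ d ≠ 0 then α u else 0) * ZMod.stdAddChar (h * (u : ZMod p))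
  have hα' (h : ZMod p) (u : ℕ) (hu : u ∈ Finset.Icc 1 U) : ‖α' h u‖ ≤ 1 := by
    simp only [α', norm_mul, norm_stdAddChar, mul_one]
    split_ifs
    · exact hα u hu
    · simp
  let T : ZMod p → ℕ → ℂ := fun h v => ∑ u ∈ Finset.Icc 1 U,
    α' h u * ZMod.stdAddChar ((v : ZMod p) / (a * (u : ZMod p) + b) ^ d)
  let D : ZMod p → ℕ → ℂ := fun h v =>
    ∑ w ∈ Finset.Icc (A v) (B v), (ZMod.stdAddChar (-(h * (w : ZMod p))) : ℂ)
  have hS : bilinearExpSumLinPow p a b d U V α β 𝓒 =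
      (p : ℂ)⁻¹ * ∑ h : ZMod p, ∑ v ∈ Finset.Icc 1 V, β v * D h v * T h v := by
    rw [bilinearExpSumLinPow, bilinearExpSum, Finset.sum_filter, Finset.sum_product_right,
      Finset.sum_comm (s := Finset.univ), Finset.mul_sum]
    refine Finset.sum_congr rfl fun v _ => ?_
    simp only [T, Finset.mul_sum]
    rw [Finset.sum_comm]
    refine Finset.sum_congr rfl fun u hu => ?_
    have hu' := Finset.mem_Icc.1 hu
    have hind := indicator_interval_eq (p := p) (A := A v) ((hB v).trans_lt hU) (hu'.2.trans_lt hU)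
    have e : ∑ h : ZMod p, (p : ℂ)⁻¹ * (β v * D h v *
        (α' h u * ZMod.stdAddChar ((v : ZMod p) / (a * (u : ZMod p) + b) ^ d))) =
        ((if (a * (u : ZMod p) + b) ^ d ≠ 0 then α u else 0) * β v *
          ZMod.stdAddChar ((v : ZMod p) / (a * (u : ZMod p) + b) ^ d)) *
        (if u ∈ Finset.Icc (A v) (B v) then (1 : ℂ) else 0) := by
      rw [hind, Finset.mul_sum, Finset.mul_sum]
      refine Finset.sum_congr rfl fun h _ => ?_
      simp only [α', D]
      ring
    rw [e]
    simp only [hAB v u hu, eval_pow, eval_add, eval_mul, eval_C, eval_X]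
    by_cases h1 : u ∈ Finset.Icc (A v) (B v) <;> by_cases h2 : (a * (u : ZMod p) + b) ^ d = 0 <;>
      simp only [h1, h2, ne_eq, not_true_eq_false, not_false_eq_true, and_true, and_false,
        if_true, if_false, zero_mul, mul_zero, mul_one]
  set R : ℝ := (V : ℝ) ^ (1 - 1 / (2 * (k : ℝ))) * (momentConst d k * (1 + Real.log p) *
        ((U : ℝ) + (U : ℝ) ^ ((k : ℝ) / ((k : ℝ) + 1)) * (p : ℝ) ^ (1 / (2 * (k : ℝ))))) with hR
  have hT (h : ZMod p) : ∑ v ∈ Finset.Icc 1 V, ‖T h v‖ ≤ R :=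
    sum_norm_linPow_le hd hk hkp ha hU1 hU hV (α' h) (hα' h)
  have hR0 : 0 ≤ R := (Finset.sum_nonneg fun _ _ => norm_nonneg _).trans (hT 0)
  rw [hS, norm_mul, norm_inv, Complex.norm_natCast]
  have hterm (h : ZMod p) :
      ‖∑ v ∈ Finset.Icc 1 V, β v * D h v * T h v‖ ≤ p * intervalMajorant h * R := by
    refine (norm_sum_le _ _).trans ?_
    have hc : 0 ≤ (p : ℝ) * intervalMajorant h := mul_nonneg hp0'.le (intervalMajorant_nonneg h)
    refine le_trans (Finset.sum_le_sum fun v hv => ?_)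
      ((Finset.mul_sum _ _ _).symm.le.trans (mul_le_mul_of_nonneg_left (hT h) hc))
    rw [norm_mul, norm_mul]
    refine mul_le_mul_of_nonneg_right ?_ (norm_nonneg _)
    have h1 : ‖D h v‖ ≤ p * intervalMajorant h := norm_sum_interval_le h (hA v) (hB v) hU
    calc ‖β v‖ * ‖D h v‖ ≤ 1 * (p * intervalMajorant h) :=
          mul_le_mul (hβ v hv) h1 (norm_nonneg _) zero_le_one
      _ = _ := one_mul _
  calc _ ≤ (p : ℝ)⁻¹ * ∑ h : ZMod p, p * intervalMajorant h * R := by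
        refine mul_le_mul_of_nonneg_left ?_ (by positivity)
        exact (norm_sum_le _ _).trans (Finset.sum_le_sum fun h _ => hterm h)
    _ = (∑ h : ZMod p, intervalMajorant h) * R := by
        rw [← Finset.sum_mul, ← Finset.mul_sum, mul_assoc, inv_mul_cancel_left₀ hp0'.ne']
    _ ≤ _ := mul_le_mul_of_nonneg_right sum_intervalMajorant_le hR0

end Bilinear

lemma eventually_mul_one_add_log_sq_le (C : ℝ) {ε : ℝ} (hε : 0 < ε) :
    ∀ᶠ x : ℝ in Filter.atTop, C * (1 + Real.log x) ^ 2 ≤ x ^ ε := by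
  have h1 : (fun x : ℝ => 1 + Real.log x) =o[Filter.atTop] fun x => x ^ (ε / 2) := by
    refine Asymptotics.IsLittleO.add ?_ (isLittleO_log_rpow_atTop (by positivity))
    rw [Asymptotics.isLittleO_const_left]
    right
    exact tendsto_norm_atTop_atTop.comp (tendsto_rpow_atTop (by positivity))
  have h2 := ((h1.pow two_pos).const_mul_left C).bound one_pos
  filter_upwards [h2, Filter.eventually_ge_atTop 0] with x hx hx0
  have e : (x ^ (ε / 2)) ^ 2 = x ^ ε := by
    rw [← Real.rpow_natCast, ← Real.rpow_mul hx0]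
    congr 1
    push_cast
    ring
  rw [e, one_mul, Real.norm_of_nonneg (Real.rpow_nonneg hx0 _)] at hx
  exact (le_abs_self _).trans hx

theorem theorem2p3 (d k : ℕ) (hd : 1 ≤ d) (hk : 1 ≤ k) (ε : ℝ) (hε : 0 < ε) :
    ∃ p₀ : ℕ, ∀ (p : ℕ) [Fact p.Prime], p₀ ≤ p →
      ∀ (U V : ℕ), 1 ≤ U → U < p → 1 ≤ V → V < p →
      ∀ (a b : ZMod p), a ≠ 0 →
      ∀ 𝓒 : Set (ℝ × ℝ), Convex ℝ 𝓒 →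
        𝓒 ⊆ Set.Icc (1 : ℝ) (U : ℝ) ×ˢ Set.Icc (1 : ℝ) (V : ℝ) →
      ∀ α β : ℕ → ℂ, (∀ u ∈ Finset.Icc 1 U, ‖α u‖ ≤ 1) → (∀ v ∈ Finset.Icc 1 V, ‖β v‖ ≤ 1) →
        ‖bilinearExpSumLinPow p a b d U V α β 𝓒‖ ≤
          (V : ℝ) ^ (1 - 1 / (2 * (k : ℝ))) *
            ((U : ℝ) + (U : ℝ) ^ ((k : ℝ) / ((k : ℝ) + 1)) * (p : ℝ) ^ (1 / (2 * (k : ℝ)))) *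
            (p : ℝ) ^ ε := by
  obtain ⟨x₀, hx₀⟩ := Filter.eventually_atTop.1
    (eventually_mul_one_add_log_sq_le (3 * momentConst d k) hε)
  -- `k + 1` secures `k < p`; `x₀` lets `p ^ ε` absorb the constant and the two factors `1 + log p`,
  -- one from completion and one from the moment bound.
  refine ⟨max (k + 1) ⌈x₀⌉₊, fun p _ hp U V hU1 hU hV1 hV a b ha 𝓒 h𝓒 _ α β hα hβ => ?_⟩
  have hkp : k < p := (le_max_left _ _).trans hp
  have hlog := hx₀ p ((Nat.le_ceil _).trans (by exact_mod_cast (le_max_right _ _).trans hp))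
  refine (norm_bilinearExpSumLinPow_le hd hk hkp ha hU1 hU hV h𝓒 α β hα hβ).trans ?_
  calc _ = (V : ℝ) ^ (1 - 1 / (2 * (k : ℝ))) *
        ((U : ℝ) + (U : ℝ) ^ ((k : ℝ) / ((k : ℝ) + 1)) * (p : ℝ) ^ (1 / (2 * (k : ℝ)))) *
          (3 * momentConst d k * (1 + Real.log p) ^ 2) := by ring
    _ ≤ _ := by gcongr
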